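/- Fix an integer $k \ge 1$. For a prime $p > 2$ with $p > k$, let $\chi$ be the quadratic character (Legendre symbol) of $\mathbb{F}_p$, and let $\Delta_{p-1}$ be the $(p-1)$-simplex on the vertex set $\mathbb{F}_p$, so that its $j$-dimensional faces are the $(j+1)$-element subsets of $\mathbb{F}_p$. Let $C^j(\Delta_{p-1})$ be the space of $\mathbb{Z}/2$-valued functions on the $j$-dimensional faces, with coboundary map $d_{k-1}\colon C^{k-1}(\Delta_{p-1}) \to C^k(\Delta_{p-1})$ given by $(d_{k-1}\psi)(\sigma) = \sum_{v\in\sigma} \psi(\sigma\setminus\{v\})$. For $\phi\in C^k(\Delta_{p-1})$ let $\|\phi\|$ be the number of $k$-dimensional faces on which $\phi$ is nonzero, and let $$\|\phi\|_{csy} = \min_{\psi\in C^{k-1}(\Delta_{p-1})} \|\phi + d_{k-1}\psi\|$$ be its cosystolic norm. Let the Paley $k$-cochain $\phi_k\in C^k(\Delta_{p-1})$ be defined by $\phi_k(\{x_0,\dots,x_k\}) = 1$ if $\chi(x_0+\dots+x_k)=1$, and $\phi_k(\{x_0,\dots,x_k\})=0$ otherwise. Then there is a constant $C = C(k)$, depending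 only on $k$, such that for every prime $p>2$ with $p>k$, $$\|\phi_k\|_{csy} \;\ge\; \frac12 \binom{p}{k+1}\left(1 - C\,p^{-2^{-k}}\right).$$ -/

import Mathlib

namespace SimplexCochain

/-- The faces with `n` vertices (that is, of dimension `n - 1`) of the simplex on the vertex
set `V`. -/
abbrev Face (V : Type*) (n : ℕ) : Type _ := {σ : Finset V // σ.card = n}

/-- Cochains with `ℤ/2` coefficients on the faces with `n` vertices. For the simplex `Δ` on the
vertex set `V`, the space of `k`-cochains `C^k(Δ)` is `Cochain V (k + 1)`. -/
abbrev Cochain (V : Type*) (n : ℕ) : Type _ := Face V n → ZMod 2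

/-- The facet of `σ` opposite to the vertex `v`. -/
def Face.erase {V : Type*} [DecidableEq V] {n : ℕ} (σ : Face V (n + 1)) (v : V)
    (hv : v ∈ σ.1) : Face V n :=
  ⟨σ.1.erase v, by rw [Finset.card_erase_of_mem hv, σ.2, Nat.add_sub_cancel]⟩

/-- The coboundary `C^{k-1} → C^k` (with `n = k`): its value at a `k`-face is the sum of the
values at the `(k-1)`-dimensional facets. -/
def coboundary {V : Type*} [DecidableEq V] {n : ℕ} (ψ : Cochain V n) : Cochain V (n + 1) :=
  fun σ => ∑ v ∈ σ.1.attach, ψ (σ.erase v.1 v.2)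

/-- The norm of a cochain: the size of its support. -/
def norm {V : Type*} [Fintype V] [DecidableEq V] {n : ℕ} (φ : Cochain V n) : ℕ :=
  (Finset.univ.filter fun σ : Face V n => φ σ ≠ 0).card

/-- The cosystolic norm of a `k`-cochain (with `n = k`): the minimum of `‖φ + dψ‖` over all
`(k-1)`-cochains `ψ`. -/
noncomputable def cosystolicNorm {V : Type*} [Fintype V] [DecidableEq V] {n : ℕ}
    (φ : Cochain V (n + 1)) : ℕ :=
  ⨅ ψ : Cochain V n, norm (φ + coboundary ψ)

/-- The Paley `k`-cochain on the `(p-1)`-simplex with vertex set `𝔽_p`: it is `1` on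
`{x₀, …, x_k}` if `χ(x₀ + ⋯ + x_k) = 1` for the quadratic character `χ`, and `0` otherwise. -/
def paley (p : ℕ) [Fact p.Prime] (k : ℕ) : Cochain (ZMod p) (k + 1) :=
  fun σ => if quadraticChar (ZMod p) (∑ x ∈ σ.1, x) = 1 then 1 else 0

end SimplexCochain

/-!
Adding a coboundary `dψ` multiplies the sign `(-1) ^ φ_k` by a product of signs each of which misses
one of the vertices `x₀, …, x_k`, so it suffices to bound sums of `χ (x₀ + ⋯ + x_k) ∏ i, f_i` in
which `f_i` is bounded by `1` and does not depend on `x_i`. The Cauchy–Schwarz inequality in all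
variables but `x₀` removes `f_0` and replaces `χ` by a product of two shifts of `χ`; this halves
the saving in the exponent at each step, and degenerates only for few values of the shift. After
`k - 1` steps a bilinear form remains, which is bounded by the largest Fourier coefficient of its
kernel, a product of distinct shifts of `χ`. That Fourier coefficient is at most `m √p` for `m`
shifts by Weil's bound.

Weil's bound comes from the `L`-function of the twisted product of shifts, a polynomial of
degree at most `m` whose inverse roots have power sums equal to the negatives of the same character
sums over the extensions of the base field. To bound the inverse roots, sum over all additive
twists: the substitution `y ↦ y ^ q - y` gives an untwisted sum over a squarefree polynomial, for
which Stepanov's method applies over extensions of large square order.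
-/

namespace Stepanov

open Polynomial
open scoped Finset

theorem eq_zero_of_squarefree_mul_sq_eq_mul_sq {R : Type*} [CommRing R] [IsDomain R]
    [IsIntegrallyClosed R] {f u a b : R} (hf : Squarefree f) (hfu : ¬IsUnit f) (hu : IsUnit u)
    (h : f * a ^ 2 = u * b ^ 2) : a = 0 := by
  by_contra ha
  obtain ⟨c, rfl⟩ : a ∣ b := (IsIntegrallyClosed.pow_dvd_pow_iff two_ne_zero).1
    (hu.dvd_mul_left.1 ⟨f, by rw [← h, mul_comm]⟩)
  have hfc : f = u * c ^ 2 := mul_right_cancel₀ (pow_ne_zero 2 ha) (by rw [h]; ring)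
  have hc : IsUnit c := hf c ⟨u, by rw [hfc]; ring⟩
  exact hfu (hfc ▸ hu.mul (hc.pow 2))

section Independence

variable {K : Type*} [Field K] {p : ℕ} [Fact p.Prime] [CharP K p] {F : K[X]}

theorem X_pow_dvd_pow_sub_C (F : K[X]) (μ : ℕ) :
    X ^ p ^ μ ∣ F ^ p ^ μ - C (F.eval 0 ^ p ^ μ) := by
  rw [C_pow, ← sub_pow_char_pow]
  refine pow_dvd_pow_of_dvd ?_ _
  rw [X_dvd_iff, coeff_zero_eq_eval_zero]
  simp

theorem eq_zero_and_eq_zero_of_X_pow_dvd (hF : Squarefree F) (hdeg : F.natDegree ≠ 0)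
    (hF0 : F.eval 0 ≠ 0) {μ ρ : ℕ} (hr : p ^ μ = 2 * ρ + 1) {a b : K[X]}
    (ha : F.natDegree + 2 * a.natDegree < p ^ μ) (hb : 2 * b.natDegree < p ^ μ)
    (h : X ^ p ^ μ ∣ a + b * F ^ ρ) : a = 0 ∧ b = 0 := by
  set c := F.eval 0 ^ p ^ μ
  have hc : IsUnit (C c) := isUnit_C.2 (pow_ne_zero _ hF0).isUnit
  -- Squaring `a ≡ -b F ^ ρ` and multiplying by `F` turns the power of `F` into `F ^ p ^ μ ≡ c`.
  have hdvd : X ^ p ^ μ ∣ F * a ^ 2 - C c * b ^ 2 := by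
    have hsplit : F * a ^ 2 - C c * b ^ 2
        = (F ^ p ^ μ - C c) * b ^ 2 + (a + b * F ^ ρ) * (F * (a - b * F ^ ρ)) := by
      rw [hr]; ring
    exact hsplit ▸ dvd_add ((X_pow_dvd_pow_sub_C F μ).mul_right _) (h.mul_right _)
  have hlt : (F * a ^ 2 - C c * b ^ 2).natDegree < p ^ μ := by
    refine (natDegree_sub_le _ _).trans_lt (max_lt ?_ ?_)
    · exact (natDegree_mul_le.trans (Nat.add_le_add_left natDegree_pow_le _)).trans_lt ha
    · exact ((natDegree_C_mul_le _ _).trans natDegree_pow_le).trans_lt hb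
  have heq : F * a ^ 2 = C c * b ^ 2 := sub_eq_zero.1 <|
    eq_zero_of_dvd_of_natDegree_lt hdvd (by rwa [natDegree_X_pow])
  have ha0 : a = 0 := eq_zero_of_squarefree_mul_sq_eq_mul_sq hF
    (fun hu => hdeg (natDegree_eq_zero_of_isUnit hu)) hc heq
  refine ⟨ha0, ?_⟩
  simpa [ha0, hc.ne_zero] using heq

/-- The auxiliary polynomial of Stepanov's method with coefficient polynomials `a i` and `b i`. -/
noncomputable def auxPoly (F : K[X]) (r ρ : ℕ) {B : ℕ} (a b : Fin B → K[X]) : K[X] :=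
  ∑ i, (a i + b i * F ^ ρ) * X ^ ((i : ℕ) * r)

theorem auxPoly_succ (F : K[X]) (r ρ : ℕ) {B : ℕ} (a b : Fin (B + 1) → K[X]) :
    auxPoly F r ρ a b =
      a 0 + b 0 * F ^ ρ + X ^ r * auxPoly F r ρ (fun i => a i.succ) fun i => b i.succ := by
  rw [auxPoly, Fin.sum_univ_succ, auxPoly, Finset.mul_sum]
  congr 1
  · simp
  · refine Finset.sum_congr rfl fun i _ => ?_
    rw [Fin.val_succ]
    ring

theorem eq_zero_of_auxPoly_eq_zero (hF : Squarefree F) (hdeg : F.natDegree ≠ 0)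
    (hF0 : F.eval 0 ≠ 0) {μ ρ : ℕ} (hr : p ^ μ = 2 * ρ + 1) {B : ℕ} {a b : Fin B → K[X]}
    (ha : ∀ i, F.natDegree + 2 * (a i).natDegree < p ^ μ)
    (hb : ∀ i, 2 * (b i).natDegree < p ^ μ) (h : auxPoly F (p ^ μ) ρ a b = 0) :
    a = 0 ∧ b = 0 := by
  induction B with
  | zero => exact ⟨Subsingleton.elim _ _, Subsingleton.elim _ _⟩
  | succ B ih =>
    rw [auxPoly_succ] at h
    obtain ⟨ha0, hb0⟩ := eq_zero_and_eq_zero_of_X_pow_dvd hF hdeg hF0 hr (ha 0) (hb 0)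
      (dvd_neg.1 (Dvd.intro _ (eq_neg_of_add_eq_zero_right h)))
    rw [ha0, hb0, zero_mul, add_zero, zero_add] at h
    obtain ⟨ha', hb'⟩ := ih (fun i => ha i.succ) (fun i => hb i.succ)
      ((mul_eq_zero.1 h).resolve_left (pow_ne_zero _ X_ne_zero))
    exact ⟨funext (Fin.cases ha0 (congrFun ha')), funext (Fin.cases hb0 (congrFun hb'))⟩

end Independence

section Construction

variable {K : Type*} [Field K] {p : ℕ} [Fact p.Prime] [CharP K p]

/-- The polynomial whose vanishing forces the auxiliary polynomial with the same coefficients to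
vanish where `F ^ (ρ * (r + 1))` takes the value `ε`. -/
noncomputable def twistedPoly (F : K[X]) (r ρ : ℕ) (ε : K) {B : ℕ} (a b : Fin B → K[X]) : K[X] :=
  ∑ i, (a i ^ r * F ^ ρ + C ε * b i ^ r) * X ^ (i : ℕ)

theorem twistedPoly_sub (F : K[X]) (μ ρ : ℕ) (ε : K) {B : ℕ} (a a' b b' : Fin B → K[X]) :
    twistedPoly F (p ^ μ) ρ ε (a - a') (b - b') =
      twistedPoly F (p ^ μ) ρ ε a b - twistedPoly F (p ^ μ) ρ ε a' b' := by
  simp only [twistedPoly, ← Finset.sum_sub_distrib, Pi.sub_apply, sub_pow_char_pow]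
  exact Finset.sum_congr rfl fun i _ => by ring

theorem natDegree_twistedPoly_lt {F : K[X]} {r ρ A : ℕ} (ε : K) {B : ℕ} (hB : B ≠ 0)
    {a b : Fin B → K[X]} (ha : ∀ i, (a i).natDegree ≤ A) (hb : ∀ i, (b i).natDegree ≤ A) :
    (twistedPoly F r ρ ε a b).natDegree < r * A + F.natDegree * ρ + B := by
  refine Nat.lt_of_le_sub_one (by lia) (natDegree_sum_le_of_forall_le _ _ fun i _ => ?_)
  have hab : (a i ^ r * F ^ ρ + C ε * b i ^ r).natDegree ≤ r * A + F.natDegree * ρ := by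
    refine (natDegree_add_le _ _).trans (max_le ?_ ?_)
    · exact natDegree_mul_le.trans (Nat.add_le_add
        (natDegree_pow_le_of_le r (ha i)) (natDegree_pow_le.trans_eq (mul_comm _ _)))
    · exact ((natDegree_C_mul_le _ _).trans (natDegree_pow_le_of_le r (hb i))).trans
        (Nat.le_add_right _ _)
  have hX := natDegree_mul_le_of_le hab (natDegree_X_pow_le (R := K) (i : ℕ))
  have := i.isLt
  lia

theorem natDegree_lt_of_mem_degreeLT {R : Type*} [Semiring R] {n : ℕ} (hn : n ≠ 0) {f : R[X]}
    (hf : f ∈ degreeLT R n) : f.natDegree < n := by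
  rcases eq_or_ne f 0 with rfl | hf0
  · simpa using hn.bot_lt
  · exact (natDegree_lt_iff_degree_lt hf0).2 (mem_degreeLT.1 hf)

instance finite_degreeLT {R : Type*} [Ring R] [Finite R] (n : ℕ) : Finite (degreeLT R n) :=
  .of_equiv _ (degreeLTEquiv R n).toEquiv.symm

theorem natCard_degreeLT (R : Type*) [Ring R] (n : ℕ) :
    Nat.card (degreeLT R n) = Nat.card R ^ n := by
  simpa [Nat.card_fun] using Nat.card_congr (degreeLTEquiv R n).toEquiv

/-- Pigeonhole: there are more pairs `(a, b)` than possible values of `twistedPoly`. -/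
theorem exists_twistedPoly_eq_zero [Finite K] (F : K[X]) (ε : K) {μ ρ A B : ℕ}
    (hcount : p ^ μ * A + F.natDegree * ρ + B < 2 * A * B) :
    ∃ a b : Fin B → K[X], (∀ i, (a i).natDegree < A) ∧ (∀ i, (b i).natDegree < A) ∧
      (a ≠ 0 ∨ b ≠ 0) ∧ twistedPoly F (p ^ μ) ρ ε a b = 0 := by
  have hA : A ≠ 0 := by rintro rfl; simp at hcount
  have hB : B ≠ 0 := by rintro rfl; simp at hcount
  set T := p ^ μ * A + F.natDegree * ρ + B
  have natDegree_lt (g : degreeLT K A) : (g : K[X]).natDegree < A :=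
    natDegree_lt_of_mem_degreeLT hA g.2
  let Φ (v : Fin B → degreeLT K A × degreeLT K A) : degreeLT K T :=
    ⟨twistedPoly F (p ^ μ) ρ ε (fun i => (v i).1) fun i => (v i).2, mem_degreeLT.2 <|
      degree_le_natDegree.trans_lt <| Nat.cast_lt.2 <| natDegree_twistedPoly_lt ε hB
        (fun i => (natDegree_lt (v i).1).le) fun i => (natDegree_lt (v i).2).le⟩
  have hΦ : ¬Function.Injective Φ := fun hinj => by
    have hle := Nat.card_le_card_of_injective Φ hinj
    rw [Nat.card_fun, Nat.card_prod, natCard_degreeLT, natCard_degreeLT, Nat.card_fin, ← pow_add,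
      ← pow_mul, ← two_mul] at hle
    exact hle.not_gt (Nat.pow_lt_pow_right Finite.one_lt_card hcount)
  obtain ⟨v, w, hvw, hne⟩ := Function.not_injective_iff.1 hΦ
  refine ⟨fun i => (v i).1 - (w i).1, fun i => (v i).2 - (w i).2,
    fun i => natDegree_lt ((v i).1 - (w i).1), fun i => natDegree_lt ((v i).2 - (w i).2), ?_, ?_⟩
  · contrapose! hne
    simp only [funext_iff, Pi.zero_apply, sub_eq_zero] at hne
    exact funext fun i => Prod.ext (Subtype.ext (hne.1 i)) (Subtype.ext (hne.2 i))
  · exact (twistedPoly_sub ..).trans (sub_eq_zero.2 (congrArg Subtype.val hvw))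

theorem eval_auxPoly_pow_mul {F : K[X]} {μ ρ B : ℕ} {a b : Fin B → K[X]} {x : K}
    (hx : x ^ (p ^ μ * p ^ μ) = x) :
    (auxPoly F (p ^ μ) ρ a b).eval x ^ p ^ μ * F.eval x ^ ρ =
      (twistedPoly F (p ^ μ) ρ (F.eval x ^ (ρ * (p ^ μ + 1))) a b).eval x := by
  simp only [auxPoly, twistedPoly, eval_finsetSum, sum_pow_char_pow, Finset.sum_mul, eval_mul,
    eval_add, eval_pow, eval_X, eval_C, mul_pow, add_pow_char_pow]
  refine Finset.sum_congr rfl fun i _ => ?_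
  have hxi : (x ^ ((i : ℕ) * p ^ μ)) ^ p ^ μ = x ^ (i : ℕ) := by
    rw [← pow_mul, mul_assoc, mul_comm, pow_mul, hx]
  rw [hxi]
  ring

theorem natDegree_auxPoly_le {F : K[X]} {r ρ A B : ℕ} {a b : Fin B → K[X]}
    (ha : ∀ i, (a i).natDegree ≤ A) (hb : ∀ i, (b i).natDegree ≤ A) :
    (auxPoly F r ρ a b).natDegree ≤ A + F.natDegree * ρ + (B - 1) * r := by
  refine natDegree_sum_le_of_forall_le _ _ fun i _ => natDegree_mul_le_of_le ?_ ?_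
  · refine (natDegree_add_le _ _).trans (max_le ((ha i).trans (Nat.le_add_right _ _)) ?_)
    exact natDegree_mul_le_of_le (hb i) (natDegree_pow_le.trans_eq (mul_comm _ _))
  · exact (natDegree_X_pow_le _).trans (Nat.mul_le_mul_right _ (Nat.le_sub_one_of_lt i.isLt))

end Construction

section Count

theorem exists_parameters {D r ρ : ℕ} (hr : r = 2 * ρ + 1) (hbig : 2 * (D + 2) ≤ r) :
    ∃ A B, D + 2 * A ≤ r ∧ r * A + D * ρ + B < 2 * A * B ∧
      2 * (A + D * ρ + (B - 1) * r) ≤ r * r + (7 * D + 6) * r := by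
  obtain ⟨A, hA, hA'⟩ : ∃ A, D + 2 * A ≤ r ∧ r ≤ D + 2 * A + 1 := ⟨(r - D) / 2, by lia, by lia⟩
  have hDA : D * (2 * ρ + 3) ≤ D * (4 * A) := Nat.mul_le_mul_left D (by lia)
  refine ⟨A, ρ + (3 * D + 3) + 1, hA, by subst hr; nlinarith, ?_⟩
  rw [Nat.add_sub_cancel]
  subst hr
  nlinarith

variable {K : Type*} [Field K] [Fintype K] [DecidableEq K] {p : ℕ} [Fact p.Prime] [CharP K p]
  {F : K[X]} {μ ρ : ℕ}

theorem card_filter_eval_pow_eq_le_of_lt (hF : Squarefree F) (hdeg : F.natDegree ≠ 0)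
    (hF0 : F.eval 0 ≠ 0) (hr : p ^ μ = 2 * ρ + 1) (hcard : Fintype.card K = p ^ μ * p ^ μ)
    {A B : ℕ} (hA : F.natDegree + 2 * A ≤ p ^ μ)
    (hcount : p ^ μ * A + F.natDegree * ρ + B < 2 * A * B) {ε : K} (hε : ε ≠ 0) :
    #{x : K | F.eval x ^ (ρ * (p ^ μ + 1)) = ε} ≤ A + F.natDegree * ρ + (B - 1) * p ^ μ := by
  obtain ⟨a, b, ha, hb, hab, htw⟩ := exists_twistedPoly_eq_zero F ε hcount
  have hne : auxPoly F (p ^ μ) ρ a b ≠ 0 := fun h => by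
    obtain ⟨rfl, rfl⟩ := eq_zero_of_auxPoly_eq_zero hF hdeg hF0 hr
      (fun i => by have := ha i; lia) (fun i => by have := hb i; lia) h
    simp at hab
  refine (card_le_degree_of_subset_roots fun x hx => (mem_roots hne).2 ?_).trans
    (natDegree_auxPoly_le (fun i => (ha i).le) fun i => (hb i).le)
  obtain rfl : F.eval x ^ (ρ * (p ^ μ + 1)) = ε := by simpa using hx
  have hzero := eval_auxPoly_pow_mul (F := F) (ρ := ρ) (a := a) (b := b)
    (hcard ▸ FiniteField.pow_card x)
  rw [htw, eval_zero, mul_eq_zero] at hzero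
  rw [IsRoot]
  refine eq_zero_of_pow_eq_zero (hzero.resolve_right fun h => hε ?_)
  rw [pow_mul, h, zero_pow (Nat.succ_ne_zero _)]

theorem two_mul_card_filter_eval_pow_eq_le (hF : Squarefree F) (hdeg : F.natDegree ≠ 0)
    (hF0 : F.eval 0 ≠ 0) (hr : p ^ μ = 2 * ρ + 1) (hcard : Fintype.card K = p ^ μ * p ^ μ)
    (hbig : 2 * (F.natDegree + 2) ≤ p ^ μ) {ε : K} (hε : ε ≠ 0) :
    2 * #{x : K | F.eval x ^ (ρ * (p ^ μ + 1)) = ε}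
      ≤ p ^ μ * p ^ μ + (7 * F.natDegree + 6) * p ^ μ := by
  obtain ⟨A, B, hA, hcount, hle⟩ := exists_parameters hr hbig
  exact (Nat.mul_le_mul_left 2
    (card_filter_eval_pow_eq_le_of_lt hF hdeg hF0 hr hcard hA hcount hε)).trans hle

end Count

section QuadraticChar

variable {K : Type*} [Field K] [Fintype K] [DecidableEq K]

theorem abs_quadraticChar_le_one (x : K) : |quadraticChar K x| ≤ 1 := by
  rcases quadraticChar_isQuadratic K x with h | h | h <;> simp [h]

theorem abs_sum_quadraticChar_le {ι : Type*} (s : Finset ι) (f : ι → K) :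
    |∑ i ∈ s, quadraticChar K (f i)| ≤ #s := by
  simpa using (s.abs_sum_le_sum_abs _).trans
    (s.sum_le_card_nsmul _ 1 fun i _ => abs_quadraticChar_le_one (f i))

theorem quadraticChar_eq_iff_pow_eq (hK : ringChar K ≠ 2) (e : ℤˣ) (x : K) :
    quadraticChar K x = e ↔ x ^ (Fintype.card K / 2) = ((e : ℤ) : K) := by
  rw [← quadraticChar_eq_pow_of_char_ne_two' hK]
  refine (Int.cast_injOn_of_ringChar_ne_two hK).eq_iff ?_ ?_ |>.symm
  · simpa [or_comm, or_left_comm] using quadraticChar_isQuadratic K x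
  · rcases Int.units_eq_one_or e with rfl | rfl <;> simp

theorem mul_sum_quadraticChar_add_card {ι : Type*} [Fintype ι] (e : ℤˣ) (f : ι → K) :
    e * ∑ i, quadraticChar K (f i) + Fintype.card ι =
      2 * #{i | quadraticChar K (f i) = e} + #{i | f i = 0} := by
  rw [Fintype.card_eq_sum_ones, Finset.mul_sum, Finset.card_filter, Finset.card_filter]
  push_cast
  rw [Finset.mul_sum, ← Finset.sum_add_distrib, ← Finset.sum_add_distrib]
  refine Finset.sum_congr rfl fun i _ => ?_
  by_cases hi : f i = 0
  · simp [hi, e.ne_zero.symm]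
  · rcases Int.units_eq_one_or e with rfl | rfl <;>
      rcases quadraticChar_dichotomy hi with h | h <;> simp [hi, h]

variable {p : ℕ} [Fact p.Prime] [CharP K p] {F : K[X]} {μ : ℕ}

theorem abs_sum_quadraticChar_eval_le_of_eval_zero_ne (hp : p ≠ 2) (hF : Squarefree F)
    (hdeg : F.natDegree ≠ 0) (hF0 : F.eval 0 ≠ 0) (hcard : Fintype.card K = p ^ μ * p ^ μ) :
    |∑ x, quadraticChar K (F.eval x)| ≤ (8 * F.natDegree + 6) * p ^ μ := by
  have hK : ringChar K ≠ 2 := by rwa [ringChar.eq K p]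
  have hr0 : 0 < p ^ μ := pow_pos (Fact.out : p.Prime).pos _
  obtain ⟨ρ, hr⟩ : Odd (p ^ μ) := ((Fact.out : p.Prime).odd_of_ne_two hp).pow
  rcases lt_or_ge (p ^ μ) (2 * (F.natDegree + 2)) with hsmall | hbig
  · refine (abs_sum_quadraticChar_le _ _).trans ?_
    rw [Finset.card_univ, hcard]
    exact_mod_cast Nat.mul_le_mul_right _ (by lia)
  have hhalf : Fintype.card K / 2 = ρ * (p ^ μ + 1) := by
    rw [hcard, hr]
    ring_nf
    lia
  have hroots : #{x | F.eval x = 0} ≤ F.natDegree :=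
    card_le_degree_of_subset_roots fun x hx => (mem_roots hF.ne_zero).2 (by simpa using hx)
  have hsigned (e : ℤˣ) :
      e * ∑ x, quadraticChar K (F.eval x) ≤ (8 * F.natDegree + 6) * p ^ μ := by
    have hε : ((e : ℤ) : K) ≠ 0 := by rcases Int.units_eq_one_or e with rfl | rfl <;> simp
    have hfib := two_mul_card_filter_eval_pow_eq_le hF hdeg hF0 hr hcard hbig hε
    have hsum := mul_sum_quadraticChar_add_card e fun x => F.eval x
    simp only [quadraticChar_eq_iff_pow_eq hK, hhalf] at hsum
    rw [hcard] at hsum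
    have hD : F.natDegree ≤ F.natDegree * p ^ μ := Nat.le_mul_of_pos_right _ hr0
    zify at hfib hroots hD
    push_cast at hsum
    linarith
  exact abs_le'.2 ⟨by simpa using hsigned 1, by simpa using hsigned (-1)⟩

theorem squarefree_taylor {R : Type*} [CommRing R] {f : R[X]} (hf : Squarefree f) (c : R) :
    Squarefree (taylor c f) := fun d hd => by
  have hdvd : taylor (-c) d * taylor (-c) d ∣ f := by
    simpa [taylor_taylor] using map_dvd (taylorAlgHom (-c)) hd
  exact (MulEquiv.isUnit_map (taylorEquiv (-c))).1 (hf _ hdvd)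

theorem abs_sum_quadraticChar_eval_le (hp : p ≠ 2) (hF : Squarefree F) (hdeg : F.natDegree ≠ 0)
    (hcard : Fintype.card K = p ^ μ * p ^ μ) :
    |∑ x, quadraticChar K (F.eval x)| ≤ (8 * F.natDegree + 6) * p ^ μ := by
  by_cases h : ∃ c, F.eval c ≠ 0
  · obtain ⟨c, hc⟩ := h
    have hbound := abs_sum_quadraticChar_eval_le_of_eval_zero_ne (F := taylor c F) hp
      (squarefree_taylor hF c) (by rwa [natDegree_taylor])
      (by rwa [taylor_eval, zero_add]) hcard
    simp only [taylor_eval, natDegree_taylor] at hbound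
    have hshift := Equiv.sum_comp (Equiv.addRight c) fun x => quadraticChar K (F.eval x)
    simp only [Equiv.coe_addRight] at hshift
    rwa [hshift] at hbound
  · push Not at h
    simp only [h, quadraticChar_zero, Finset.sum_const_zero, abs_zero]
    positivity

end QuadraticChar

end Stepanov

namespace WeilBound

open Polynomial
open scoped Finset

section FieldPoly

open IntermediateField Module

variable {K L : Type*} [Field K] [Field L] [Algebra K L]

/-- The characteristic polynomial over `K` of multiplication by `x : L`, as a power of the
minimal polynomial. -/
noncomputable def fieldPoly (K : Type*) {L : Type*} [Field K] [Field L] [Algebra K L] (x : L) :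
    K[X] :=
  minpoly K x ^ finrank K⟮x⟯ L

variable [FiniteDimensional K L] (x : L)

theorem fieldPoly_monic : (fieldPoly K x).Monic :=
  (minpoly.monic (IsIntegral.of_finite K x)).pow _

theorem natDegree_minpoly_mul_finrank :
    (minpoly K x).natDegree * finrank K⟮x⟯ L = finrank K L := by
  rw [← adjoin.finrank (IsIntegral.of_finite K x), finrank_mul_finrank]

theorem fieldPoly_eq_pow_div :
    fieldPoly K x = minpoly K x ^ (finrank K L / (minpoly K x).natDegree) := by
  rw [fieldPoly, Nat.eq_div_of_mul_eq_right
    (minpoly.natDegree_pos (IsIntegral.of_finite K x)).ne' (natDegree_minpoly_mul_finrank x)]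

theorem minpoly_dvd_fieldPoly : minpoly K x ∣ fieldPoly K x :=
  dvd_pow_self _ finrank_pos.ne'

theorem natDegree_fieldPoly : (fieldPoly K x).natDegree = finrank K L := by
  rw [fieldPoly, natDegree_pow, mul_comm, natDegree_minpoly_mul_finrank]

theorem nextCoeff_fieldPoly : (fieldPoly K x).nextCoeff = -Algebra.trace K L x := by
  rw [fieldPoly, (minpoly.monic (IsIntegral.of_finite K x)).nextCoeff_pow,
    trace_eq_finrank_mul_minpoly_nextCoeff, nsmul_eq_mul, mul_neg, neg_neg]

theorem norm_algebraMap_sub_gen {S : Type*} [CommRing S] [Algebra K S] (pb : PowerBasis K S)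
    (a : K) : Algebra.norm K (algebraMap K S a - pb.gen) = (minpoly K pb.gen).eval a := by
  rw [Algebra.norm_eq_matrix_det pb.basis, ← charpoly_leftMulMatrix, Matrix.eval_charpoly,
    map_sub]
  congr 2
  exact AlgHom.commutes _ _

theorem eval_fieldPoly (a : K) :
    (fieldPoly K x).eval a = Algebra.norm K (algebraMap K L a - x) := by
  have hx := IsIntegral.of_finite K x
  have hnorm := norm_algebraMap_sub_gen (adjoin.powerBasis hx) a
  rw [adjoin.powerBasis_gen hx, minpoly_gen] at hnorm
  have hlift : algebraMap K L a - x
      = algebraMap K⟮x⟯ L (algebraMap K K⟮x⟯ a - AdjoinSimple.gen K x) := by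
    rw [map_sub, AdjoinSimple.algebraMap_gen, ← IsScalarTower.algebraMap_apply]
  rw [hlift, ← Algebra.norm_norm (S := K⟮x⟯), Algebra.norm_algebraMap, map_pow, hnorm, fieldPoly,
    eval_pow]

end FieldPoly

section Count

open Module UniqueFactorizationMonoid

variable {K : Type*} [Field K]

open scoped Classical in
theorem pow_dvd_iff_le_count {P g : K[X]} (hP : Irreducible P) (hPm : P.Monic) (hg : g ≠ 0)
    {j : ℕ} : P ^ j ∣ g ↔ j ≤ (normalizedFactors g).count P := by
  rw [pow_dvd_iff_le_emultiplicity, emultiplicity_eq_count_normalizedFactors hP hg,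
    hPm.normalize_eq_self, Nat.cast_le]

open scoped Classical in
theorem sum_count_mul_natDegree {g : K[X]} (hg : g.Monic) :
    ∑ P ∈ (normalizedFactors g).toFinset, (normalizedFactors g).count P * P.natDegree =
      g.natDegree := by
  conv_rhs => rw [← hg.normalize_eq_self, ← prod_normalizedFactors_eq hg.ne_zero]
  rw [natDegree_multiset_prod_of_monic, Finset.sum_multiset_map_count]
  · simp only [smul_eq_mul]
  · exact fun f hf => ((Polynomial.mem_normalizedFactors_iff hg.ne_zero).1 hf).2.1

variable [Finite K]

open scoped Classical in
theorem card_filter_minpoly_eq {L : Type*} [Field L] [Fintype L] [Algebra K L] {P : K[X]}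
    (hP : Irreducible P) (hPm : P.Monic) (hdeg : P.natDegree ∣ finrank K L) :
    #{x : L | minpoly K x = P} = P.natDegree := by
  have hdvd : P ∣ X ^ Fintype.card L - X := by
    rw [← Nat.card_eq_fintype_card, natCard_eq_pow_finrank (K := K)]
    exact hP.natDegree_dvd_iff_dvd_X_pow_card_pow_sub_X.1 hdeg
  have hsplit : (P.map (algebraMap K L)).Splits := by
    refine (IsSplittingField.splits L (X ^ Fintype.card L - X : K[X])).of_dvd
      (Polynomial.map_ne_zero (FiniteField.X_pow_card_sub_X_ne_zero _ Fintype.one_lt_card))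
      (Polynomial.map_dvd _ hdvd)
  rw [← card_rootSet_eq_natDegree (PerfectField.separable_of_irreducible hP) hsplit,
    ← Set.toFinset_card]
  congr 1
  ext x
  simp only [Finset.mem_filter, Finset.mem_univ, true_and, Set.mem_toFinset, mem_rootSet]
  constructor
  · rintro rfl
    exact ⟨hP.ne_zero, minpoly.aeval _ _⟩
  · exact fun h => (minpoly.eq_of_irreducible_of_monic hP h.2 hPm).symm

open scoped Classical in
theorem card_filter_fieldPoly_dvd {L : Type*} [Field L] [Fintype L] [Algebra K L] {g : K[X]}
    (hg : g.Monic) :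
    #{x : L | fieldPoly K x ∣ g} = ∑ P ∈ (normalizedFactors g).toFinset,
      if P.natDegree ∣ finrank K L ∧ finrank K L / P.natDegree ≤ (normalizedFactors g).count P
        then P.natDegree else 0 := by
  have mem_factors (P : K[X]) :
      P ∈ (normalizedFactors g).toFinset ↔ Irreducible P ∧ P.Monic ∧ P ∣ g := by
    rw [Multiset.mem_toFinset, Polynomial.mem_normalizedFactors_iff hg.ne_zero]
  rw [Finset.card_eq_sum_card_fiberwise (f := fun x : L => minpoly K x)
    (t := (normalizedFactors g).toFinset)]
  · refine Finset.sum_congr rfl fun P hP => ?_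
    obtain ⟨hi, hm, -⟩ := (mem_factors P).1 hP
    rw [Finset.filter_filter]
    split_ifs with h
    · rw [← card_filter_minpoly_eq hi hm h.1]
      refine congrArg Finset.card (Finset.filter_congr fun x _ => and_iff_right_of_imp ?_)
      rintro rfl
      rw [fieldPoly_eq_pow_div, pow_dvd_iff_le_count hi hm hg.ne_zero]
      exact h.2
    · rw [Finset.card_eq_zero, Finset.filter_eq_empty_iff]
      rintro x - ⟨hdvd, rfl⟩
      rw [fieldPoly_eq_pow_div, pow_dvd_iff_le_count hi hm hg.ne_zero] at hdvd
      exact h ⟨⟨_, (natDegree_minpoly_mul_finrank x).symm⟩, hdvd⟩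
  · intro x hx
    have hint := IsIntegral.of_finite K x
    rw [Finset.mem_coe, mem_factors]
    exact ⟨minpoly.irreducible hint, minpoly.monic hint,
      (minpoly_dvd_fieldPoly x).trans (by simpa using hx)⟩

theorem card_filter_dvd_div_le {N d v : ℕ} (hd : 0 < d) (h : v * d ≤ N) :
    #{r ∈ Finset.range N | d ∣ r + 1 ∧ (r + 1) / d ≤ v} = v := by
  have hset : {r ∈ Finset.range N | d ∣ r + 1 ∧ (r + 1) / d ≤ v}
      = {r ∈ Finset.range (v * d) | d ∣ r + 1} := by
    ext r
    simp only [Finset.mem_filter, Finset.mem_range]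
    constructor
    · rintro ⟨-, ⟨j, hj⟩, hle⟩
      rw [hj, Nat.mul_div_cancel_left _ hd] at hle
      exact ⟨by nlinarith, j, hj⟩
    · rintro ⟨hr, j, hj⟩
      rw [hj, Nat.mul_div_cancel_left _ hd]
      exact ⟨by omega, ⟨j, rfl⟩, by nlinarith⟩
  rw [hset, Nat.card_multiples, Nat.mul_div_cancel _ hd]

variable {L : ℕ → Type*} [∀ r, Field (L r)] [∀ r, Fintype (L r)] [∀ r, Algebra K (L r)]

open scoped Classical in
theorem sum_card_filter_fieldPoly_dvd (hL : ∀ r, finrank K (L r) = r + 1) {g : K[X]}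
    (hg : g.Monic) :
    ∑ r ∈ Finset.range g.natDegree, #{x : L r | fieldPoly K x ∣ g} = g.natDegree := by
  simp only [card_filter_fieldPoly_dvd hg, hL]
  rw [Finset.sum_comm]
  conv_rhs => rw [← sum_count_mul_natDegree hg]
  refine Finset.sum_congr rfl fun P hP => ?_
  have hdeg : 0 < P.natDegree :=
    ((Polynomial.mem_normalizedFactors_iff hg.ne_zero).1
      (Multiset.mem_toFinset.1 hP)).1.natDegree_pos
  rw [← Finset.sum_filter, Finset.sum_const, smul_eq_mul, card_filter_dvd_div_le hdeg]
  rw [← sum_count_mul_natDegree hg]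
  exact Finset.single_le_sum
    (f := fun P => (normalizedFactors g).count P * P.natDegree) (fun _ _ => Nat.zero_le _) hP

end Count

section EulerProduct

open Module

variable {K : Type*} [Field K] [Finite K]

theorem finite_setOf_monic_natDegree_eq (K : Type*) [Field K] [Finite K] (n : ℕ) :
    {g : K[X] | g.Monic ∧ g.natDegree = n}.Finite :=
  Finite.of_equiv _ (monicEquivDegreeLT n).symm

/-- The monic polynomials of degree `n` over a finite field. -/
noncomputable def monicFinset (K : Type*) [Field K] [Finite K] (n : ℕ) : Finset K[X] :=
  (finite_setOf_monic_natDegree_eq K n).toFinset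

theorem mem_monicFinset {n : ℕ} {g : K[X]} :
    g ∈ monicFinset K n ↔ g.Monic ∧ g.natDegree = n :=
  Set.Finite.mem_toFinset _

theorem monicFinset_zero : monicFinset K 0 = {1} := by
  ext g
  rw [mem_monicFinset, Finset.mem_singleton]
  refine ⟨fun ⟨hm, hd⟩ => hm.natDegree_eq_zero.1 hd, ?_⟩
  rintro rfl
  exact ⟨monic_one, natDegree_one⟩

theorem add_mem_monicFinset {n : ℕ} {g h : K[X]} (hg : g ∈ monicFinset K n)
    (hh : h.natDegree < n) : g + h ∈ monicFinset K n := by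
  rw [mem_monicFinset] at hg ⊢
  have hlt : h.degree < g.degree := degree_lt_degree (hg.2.symm ▸ hh)
  exact ⟨hg.1.add_of_left hlt, by rw [natDegree_add_eq_left_of_degree_lt hlt, hg.2]⟩

theorem sum_monicFinset_add {n : ℕ} {h : K[X]} (hh : h.natDegree < n) (f : K[X] → ℂ) :
    ∑ g ∈ monicFinset K n, f (g + h) = ∑ g ∈ monicFinset K n, f g :=
  Finset.sum_bij' (fun g _ => g + h) (fun g _ => g + -h) (fun _ hg => add_mem_monicFinset hg hh)
    (fun _ hg => add_mem_monicFinset hg (by rwa [natDegree_neg])) (by simp) (by simp) (by simp)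

/-- The generating function `∑_g lam(g) X ^ deg g` over monic polynomials `g`. -/
noncomputable def lSeries (lam : K[X] → ℂ) : PowerSeries ℂ :=
  .mk fun n => ∑ g ∈ monicFinset K n, lam g

open scoped Classical in
theorem sum_monicFinset_filter_dvd {lam : K[X] → ℂ}
    (hmul : ∀ f g, f.Monic → g.Monic → lam (f * g) = lam f * lam g) {f : K[X]} (hf : f.Monic)
    (n : ℕ) :
    ∑ g ∈ monicFinset K (n + f.natDegree) with f ∣ g, lam g
      = lam f * ∑ g ∈ monicFinset K n, lam g := by
  have himage : {g ∈ monicFinset K (n + f.natDegree) | f ∣ g} =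
      (monicFinset K n).image (f * ·) := by
    ext g
    simp only [Finset.mem_filter, Finset.mem_image, mem_monicFinset]
    constructor
    · rintro ⟨⟨hm, hd⟩, c, rfl⟩
      have hc := hf.of_mul_monic_left hm
      rw [hf.natDegree_mul hc] at hd
      exact ⟨c, ⟨hc, by lia⟩, rfl⟩
    · rintro ⟨c, ⟨hc, rfl⟩, rfl⟩
      exact ⟨⟨hf.mul hc, by rw [hf.natDegree_mul hc, add_comm]⟩, dvd_mul_right _ _⟩
  rw [himage, Finset.sum_image fun _ _ _ _ h => mul_left_cancel₀ hf.ne_zero h, Finset.mul_sum]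
  exact Finset.sum_congr rfl fun g hg => hmul _ _ hf (mem_monicFinset.1 hg).1

variable {L : ℕ → Type*} [∀ r, Field (L r)] [∀ r, Fintype (L r)] [∀ r, Algebra K (L r)]

/-- The generating function of the sums of `lam` over the field polynomials of the elements of
the extensions `L r / K`. -/
noncomputable def extensionSeries (L : ℕ → Type*) [∀ r, Field (L r)] [∀ r, Fintype (L r)]
    [∀ r, Algebra K (L r)] (lam : K[X] → ℂ) : PowerSeries ℂ :=
  .mk fun r => ∑ x : L r, lam (fieldPoly K x)

theorem derivative_lSeries {lam : K[X] → ℂ}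
    (hmul : ∀ f g, f.Monic → g.Monic → lam (f * g) = lam f * lam g)
    (hL : ∀ r, finrank K (L r) = r + 1) :
    PowerSeries.derivative ℂ (lSeries lam) = extensionSeries L lam * lSeries lam := by
  classical
  ext n
  have hcount : ∀ g ∈ monicFinset K (n + 1), lam g * (n + 1)
      = ∑ r ∈ Finset.range (n + 1), ∑ x : L r with fieldPoly K x ∣ g, lam g := by
    intro g hg
    obtain ⟨hm, hdeg⟩ := mem_monicFinset.1 hg
    simp only [Finset.sum_const, nsmul_eq_mul, ← Finset.sum_mul, ← Nat.cast_sum]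
    rw [← hdeg, sum_card_filter_fieldPoly_dvd hL hm, hdeg, Nat.cast_succ, mul_comm]
  have hdvd : ∀ r ∈ Finset.range (n + 1), ∀ x : L r,
      ∑ g ∈ monicFinset K (n + 1) with fieldPoly K x ∣ g, lam g
        = lam (fieldPoly K x) * ∑ g ∈ monicFinset K (n - r), lam g := by
    intro r hr x
    rw [← sum_monicFinset_filter_dvd hmul (fieldPoly_monic x), natDegree_fieldPoly, hL,
      show n - r + (r + 1) = n + 1 by have := Finset.mem_range.1 hr; lia]
  rw [PowerSeries.coeff_derivative, PowerSeries.coeff_mul,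
    Finset.Nat.sum_antidiagonal_eq_sum_range_succ_mk]
  simp only [lSeries, extensionSeries, PowerSeries.coeff_mk, Finset.sum_mul]
  rw [Finset.sum_congr rfl hcount, Finset.sum_comm]
  refine Finset.sum_congr rfl fun r hr => ?_
  simp only [← hdvd r hr, Finset.sum_filter]
  exact Finset.sum_comm

end EulerProduct

section PowerSums

open Filter Topology

theorem exists_eq_prod_one_sub_C_mul_X {F : Type*} [Field F] [IsAlgClosed F] {Q : F[X]}
    (hQ : Q.coeff 0 = 1) :
    ∃ t : Multiset F, t.card ≤ Q.natDegree ∧ Q = (t.map fun ω => 1 - C ω * X).prod := by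
  have hroot : ∀ r ∈ Q.roots, r ≠ 0 := by
    rintro r hr rfl
    rw [mem_roots', IsRoot.def, ← coeff_zero_eq_eval_zero, hQ] at hr
    exact one_ne_zero hr.2
  have hfactor : ∀ r ∈ Q.roots, X - C r = C (-r) * (1 - C r⁻¹ * X) := by
    intro r hr
    rw [mul_sub, ← mul_assoc, ← C_mul, neg_mul, mul_inv_cancel₀ (hroot r hr)]
    simp only [C_neg, C_1]
    ring
  have hprod := (IsAlgClosed.splits Q).eq_prod_roots
  rw [Multiset.map_congr rfl hfactor, Multiset.prod_map_mul, ← mul_assoc] at hprod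
  have hlead : C Q.leadingCoeff * (Q.roots.map fun r => C (-r)).prod = 1 := by
    have hcoeff := congrArg (coeff · 0) hprod
    simp only [mul_coeff_zero, coeff_zero_multiset_prod, Multiset.map_map, Function.comp_def,
      coeff_C_zero, coeff_sub, coeff_one_zero, coeff_X_zero, mul_zero, sub_zero,
      Multiset.map_const', Multiset.prod_replicate, one_pow, mul_one, hQ] at hcoeff
    rw [← C_1, hcoeff, C_mul, map_multiset_prod, Multiset.map_map]
    rfl
  refine ⟨Q.roots.map (·⁻¹), ?_, ?_⟩
  · rw [Multiset.card_map]
    exact card_roots' Q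
  · rw [hlead, one_mul] at hprod
    rw [Multiset.map_map]
    exact hprod

theorem mk_pow_mul_one_sub {R : Type*} [CommRing R] (ω : R) :
    (.mk (ω ^ ·) : PowerSeries R) * (1 - PowerSeries.C ω * PowerSeries.X) = 1 := by
  have h := congrArg (PowerSeries.rescale ω) (PowerSeries.mk_one_mul_one_sub_eq_one R)
  simpa only [map_mul, map_sub, map_one, PowerSeries.rescale_mk, PowerSeries.rescale_X,
    Pi.one_apply, mul_one] using h

theorem derivative_prod_one_sub {R : Type*} [CommRing R] (t : Multiset R) :
    PowerSeries.derivative R (t.map fun ω => 1 - PowerSeries.C ω * PowerSeries.X).prod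
      = -(.mk fun r => (t.map (· ^ (r + 1))).sum) *
        (t.map fun ω => 1 - PowerSeries.C ω * PowerSeries.X).prod := by
  induction t using Multiset.induction with
  | empty =>
    have h0 : (.mk fun _ => 0 : PowerSeries R) = 0 := rfl
    simp [h0]
  | cons ω t ih =>
    have hmk : (.mk fun r => ((ω ::ₘ t).map (· ^ (r + 1))).sum : PowerSeries R)
        = PowerSeries.C ω * .mk (ω ^ ·) + .mk fun r => (t.map (· ^ (r + 1))).sum := by
      ext n
      simp [pow_succ']
    have hder : PowerSeries.derivative R (1 - PowerSeries.C ω * PowerSeries.X)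
        = -PowerSeries.C ω := by
      ext n
      simp [PowerSeries.coeff_C]
    rw [Multiset.map_cons, Multiset.prod_cons, Derivation.leibniz, ih, hder, hmk, smul_eq_mul,
      smul_eq_mul]
    linear_combination PowerSeries.C ω *
      (t.map fun ω => 1 - PowerSeries.C ω * PowerSeries.X).prod * mk_pow_mul_one_sub ω

theorem exists_coeff_eq_neg_sum_pow {F : Type*} [Field F] [IsAlgClosed F] {Q : F[X]}
    (hQ : Q.coeff 0 = 1) {S : PowerSeries F}
    (hS : PowerSeries.derivative F Q = S * Q) :
    ∃ t : Multiset F, t.card ≤ Q.natDegree ∧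
      ∀ r, PowerSeries.coeff r S = -(t.map (· ^ (r + 1))).sum := by
  obtain ⟨t, ht, hprod⟩ := exists_eq_prod_one_sub_C_mul_X hQ
  refine ⟨t, ht, fun r => ?_⟩
  have hcoe : (Q : PowerSeries F)
      = (t.map fun ω => 1 - PowerSeries.C ω * PowerSeries.X).prod := by
    conv_lhs => rw [hprod, ← coeToPowerSeries.ringHom_apply, map_multiset_prod, Multiset.map_map]
    simp [Function.comp_def]
  have hne : (Q : PowerSeries F) ≠ 0 := by
    rw [Ne, Polynomial.coe_eq_zero_iff]
    rintro rfl
    simp at hQ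
  rw [hcoe, derivative_prod_one_sub, ← hcoe] at hS
  rw [← mul_right_cancel₀ hne hS, map_neg, PowerSeries.coeff_mk]

theorem frequently_forall_re_pow {ι : Type*} (s : Finset ι) (z : ι → Circle) :
    ∃ᶠ n : ℕ in atTop, ∀ i ∈ s, 1 / 2 ≤ ((z i : ℂ) ^ n).re := by
  have hopen : IsOpen {w : ι → Circle | ∀ i ∈ s, 1 / 2 < (w i : ℂ).re} := by
    simp only [Set.ofPred_forall]
    exact isOpen_biInter_finset fun i _ => isOpen_lt (by fun_prop) (by fun_prop)
  refine ((mapClusterPt_one_atTop_pow z).frequently (hopen.mem_nhds ?_)).mono ?_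
  · intro i _
    norm_num
  · intro n hn i hi
    simpa using (hn i hi).le

theorem norm_pow_le_two_mul_norm_sum_pow {t : Multiset ℂ} {n : ℕ}
    (h : ∀ w ∈ t, 1 / 2 ≤ ((Circle.exp w.arg : ℂ) ^ n).re) {w : ℂ} (hw : w ∈ t) :
    ‖w‖ ^ n ≤ 2 * ‖(t.map (· ^ n)).sum‖ := by
  have hre : ∀ w ∈ t, ‖w‖ ^ n / 2 ≤ (w ^ n).re := by
    intro w hw
    have hpolar : w ^ n = (‖w‖ ^ n : ℝ) * (Circle.exp w.arg : ℂ) ^ n := by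
      rw [Complex.ofReal_pow, ← mul_pow, Circle.coe_exp, Complex.norm_mul_exp_arg_mul_I]
    rw [hpolar, Complex.re_ofReal_mul, div_eq_mul_one_div]
    gcongr
    exact h w hw
  have hsum : (w ^ n).re ≤ (t.map (· ^ n)).sum.re := by
    rw [← Complex.coe_reAddGroupHom, map_multiset_sum]
    refine Multiset.single_le_sum (fun x hx => ?_) _
      (Multiset.mem_map_of_mem _ (Multiset.mem_map_of_mem _ hw))
    simp only [Multiset.mem_map] at hx
    obtain ⟨-, ⟨v, hv, rfl⟩, rfl⟩ := hx
    exact (by positivity : 0 ≤ ‖v‖ ^ n / 2).trans (hre v hv)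
  have hnorm := Complex.re_le_norm (t.map (· ^ n)).sum
  linarith [hre w hw]

theorem norm_le_of_norm_sum_pow_le {t : Multiset ℂ} {C R : ℝ} (hR : 0 < R)
    (h : ∀ n, ‖(t.map (· ^ (n + 1))).sum‖ ≤ C * R ^ (n + 1)) {w : ℂ} (hw : w ∈ t) :
    ‖w‖ ≤ R := by
  classical
  by_contra! hlt
  have hgrow : Tendsto (fun n : ℕ => (‖w‖ / R) ^ n) atTop atTop :=
    tendsto_pow_atTop_atTop_of_one_lt ((one_lt_div hR).2 hlt)
  obtain ⟨n, hre, hbig, hn⟩ := ((frequently_forall_re_pow t.toFinset fun w => Circle.exp w.arg)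
    |>.and_eventually ((hgrow.eventually_gt_atTop (2 * C)).and (eventually_ge_atTop 1))).exists
  obtain ⟨m, rfl⟩ := Nat.exists_eq_add_of_le' hn
  have hpow := norm_pow_le_two_mul_norm_sum_pow (fun w hw => hre w (Multiset.mem_toFinset.2 hw)) hw
  rw [div_pow, lt_div_iff₀ (by positivity)] at hbig
  linarith [h m]

end PowerSums

section FiniteFieldMaps

open Module

variable {K L : Type*} [Field K] [Fintype K] [Field L] [Fintype L] [Algebra K L]

theorem quadraticChar_norm [DecidableEq K] [DecidableEq L] (hK : ringChar K ≠ 2) (y : L) :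
    quadraticChar K (Algebra.norm K y) = quadraticChar L y := by
  have hL : ringChar L ≠ 2 := by rwa [← Algebra.ringChar_eq K L]
  refine (quadraticChar_isQuadratic K).eq_of_eq_coe (quadraticChar_isQuadratic L) hL ?_
  have hnorm := congrArg (algebraMap K L)
    (quadraticChar_eq_pow_of_char_ne_two' hK (Algebra.norm K y))
  rw [map_intCast, map_pow, FiniteField.algebraMap_norm_eq_pow, ← pow_mul] at hnorm
  rw [hnorm, quadraticChar_eq_pow_of_char_ne_two' hL]
  congr 1
  obtain ⟨t, ht⟩ : Fintype.card K - 1 ∣ Fintype.card L - 1 := by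
    rw [Module.card_eq_pow_finrank (K := K) (V := L)]
    simpa using Nat.sub_dvd_pow_sub_pow (Fintype.card K) 1 (finrank K L)
  have hodd := FiniteField.odd_card_of_char_ne_two hK
  have hoddL := FiniteField.odd_card_of_char_ne_two hL
  have hcard : 1 < Fintype.card K := Fintype.one_lt_card
  rw [Nat.card_eq_fintype_card, Nat.card_eq_fintype_card, ht,
    Nat.mul_div_cancel_left _ (by lia)]
  have ht' : Fintype.card L - 1 = 2 * (Fintype.card K / 2 * t) := by
    rw [ht, ← mul_assoc]
    congr 1
    lia
  rw [mul_comm]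
  lia

theorem card_filter_trace_eq_zero_mul [DecidableEq K] :
    #{x : L | Algebra.trace K L x = 0} * Fintype.card K = Fintype.card L := by
  have hfiber (y : K) :
      #{x : L | Algebra.trace K L x = y} = #{x : L | Algebra.trace K L x = 0} :=
    AddMonoidHom.card_fiber_eq_of_mem_range (Algebra.trace K L)
      (Algebra.trace_surjective K L y) (Algebra.trace_surjective K L 0)
  have hcard : Fintype.card L = ∑ y : K, #{x : L | Algebra.trace K L x = y} :=
    Finset.card_eq_sum_card_fiberwise fun _ _ => Finset.mem_coe.2 (Finset.mem_univ _)
  simp only [hcard, hfiber, Finset.sum_const, Finset.card_univ, smul_eq_mul, mul_comm]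

theorem trace_pow_card {L : Type*} [Field L] [Finite L] [Algebra K L] (z : L) :
    Algebra.trace K L (z ^ Fintype.card K) = Algebra.trace K L z :=
  Algebra.trace_eq_of_algEquiv (FiniteField.frobeniusAlgEquivOfAlgebraic K L) z

theorem card_filter_pow_sub_le {q : ℕ} [DecidableEq L] (hq : 1 < q) (x : L) :
    #{z : L | z ^ q - z = x} ≤ q := by
  have hdeg : (X ^ q - X - C x : L[X]).natDegree = q := by
    rw [natDegree_sub_C, FiniteField.X_pow_card_sub_X_natDegree_eq L hq]
  have hne : (X ^ q - X - C x : L[X]) ≠ 0 := ne_zero_of_natDegree_gt (hdeg ▸ hq)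
  conv_rhs => rw [← hdeg]
  refine card_le_degree_of_subset_roots fun z hz => ?_
  rw [mem_roots hne]
  simpa [sub_eq_zero] using hz

/-- The additive form of Hilbert's theorem 90, with the size of the fibres. -/
theorem card_filter_pow_card_sub_eq [DecidableEq K] [DecidableEq L] (x : L) :
    #{z : L | z ^ Fintype.card K - z = x}
      = if Algebra.trace K L x = 0 then Fintype.card K else 0 := by
  have hle : ∀ x ∈ Finset.univ, #{z : L | z ^ Fintype.card K - z = x}
      ≤ if Algebra.trace K L x = 0 then Fintype.card K else 0 := by
    intro x _
    split_ifs with h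
    · exact card_filter_pow_sub_le Fintype.one_lt_card x
    · rw [Nat.le_zero, Finset.card_eq_zero, Finset.filter_eq_empty_iff]
      rintro z - rfl
      exact h (by rw [map_sub, trace_pow_card, sub_self])
  refine (Finset.sum_eq_sum_iff_of_le hle).1 ?_ x (Finset.mem_univ x)
  rw [← Finset.card_eq_sum_card_fiberwise fun _ _ => Finset.mem_coe.2 (Finset.mem_univ _),
    ← Finset.sum_filter, Finset.sum_const, smul_eq_mul, card_filter_trace_eq_zero_mul,
    Finset.card_univ]

theorem sum_sum_mul_addChar_trace (G : L → ℂ) :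
    ∑ ψ : AddChar K ℂ, ∑ x : L, G x * ψ (-Algebra.trace K L x)
      = ∑ z : L, G (z ^ Fintype.card K - z) := by
  have := Classical.decEq K
  have := Classical.decEq L
  rw [← Finset.sum_fiberwise (g := fun z : L => z ^ Fintype.card K - z), Finset.sum_comm]
  refine Finset.sum_congr rfl fun x _ => ?_
  rw [← Finset.mul_sum, AddChar.sum_apply_eq_ite,
    Finset.sum_congr rfl (g := fun _ => G x) fun z hz => by rw [(Finset.mem_filter.1 hz).2],
    Finset.sum_const, card_filter_pow_card_sub_eq]
  simp only [neg_eq_zero, nsmul_eq_mul, Nat.cast_ite, Nat.cast_zero, mul_comm]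

end FiniteFieldMaps

section ArtinSchreier

variable {L : Type*} [Field L] (B : Finset L) {q : ℕ}

theorem squarefree_prod_C_sub_X_pow_sub_X (hq : (q : L) = 0) :
    Squarefree (∏ b ∈ B, (C b - (X ^ q - X)) : L[X]) := by
  refine (separable_prod' (fun b _ c _ hbc => ?_) fun b _ => ?_).squarefree
  · refine ⟨C (b - c)⁻¹, -C (b - c)⁻¹, ?_⟩
    have hinv : (C (b - c)⁻¹ : L[X]) * C (b - c) = 1 := by
      rw [← C_mul, inv_mul_cancel₀ (sub_ne_zero.2 hbc), C_1]
    rw [C_sub] at hinv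
    linear_combination hinv
  · have hder : derivative (C b - (X ^ q - X) : L[X]) = 1 := by
      simp [derivative_X_pow, hq]
    rw [separable_def, hder]
    exact isCoprime_one_right

theorem natDegree_prod_C_sub_X_pow_sub_X (hq : 1 < q) :
    (∏ b ∈ B, (C b - (X ^ q - X)) : L[X]).natDegree = #B * q := by
  have hdeg (b : L) : (C b - (X ^ q - X) : L[X]).natDegree = q := by
    rw [← neg_sub, natDegree_neg, natDegree_sub_C,
      FiniteField.X_pow_card_sub_X_natDegree_eq L hq]
  rw [natDegree_prod _ _ fun b _ => ne_zero_of_natDegree_gt (hdeg b ▸ hq)]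
  simp only [hdeg, Finset.sum_const, smul_eq_mul]

end ArtinSchreier

section HybridSums

open Module

variable {K : Type*} [Field K] [Fintype K] [DecidableEq K] (A : Finset K) (ψ : AddChar K ℂ)

/-- The multiplicative function on monic polynomials which takes the value
`(∏ a ∈ A, χ (a - x)) * ψ (-x)` at `X - x`, for the quadratic character `χ`. -/
noncomputable def hybridChar (g : K[X]) : ℂ :=
  (∏ a ∈ A, quadraticChar K (g.eval a) : ℤ) * ψ g.nextCoeff

theorem hybridChar_mul {f g : K[X]} (hf : f.Monic) (hg : g.Monic) :
    hybridChar A ψ (f * g) = hybridChar A ψ f * hybridChar A ψ g := by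
  simp only [hybridChar, eval_mul, map_mul, Finset.prod_mul_distrib, hf.nextCoeff_mul hg,
    AddChar.map_add_eq_mul, Int.cast_mul]
  ring

theorem monicFinset_one : monicFinset K 1 = Finset.univ.image fun x => X - C x := by
  ext g
  simp only [mem_monicFinset, Finset.mem_image, Finset.mem_univ, true_and]
  constructor
  · rintro ⟨hm, hd⟩
    exact ⟨-g.coeff 0, by rw [C_neg, sub_neg_eq_add, ← hm.eq_X_add_C hd]⟩
  · rintro ⟨x, rfl⟩
    exact ⟨monic_X_sub_C x, natDegree_X_sub_C x⟩

theorem coeff_zero_lSeries_hybridChar :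
    PowerSeries.coeff 0 (lSeries (hybridChar A ψ)) = 1 := by
  simp [lSeries, monicFinset_zero, hybridChar, nextCoeff]

theorem coeff_one_lSeries_hybridChar :
    PowerSeries.coeff 1 (lSeries (hybridChar A ψ)) =
      ∑ x : K, (∏ a ∈ A, quadraticChar K (a - x) : ℤ) * ψ (-x) := by
  rw [lSeries, PowerSeries.coeff_mk, monicFinset_one,
    Finset.sum_image fun x _ y _ h => C_injective (sub_right_injective h)]
  simp [hybridChar]

theorem sum_quadraticChar_add_mul (hK : ringChar K ≠ 2) (y : K) {z : K} (hz : z ≠ 0) :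
    ∑ c : K, quadraticChar K (y + c * z) = 0 := by
  rw [← quadraticChar_sum_zero hK]
  exact Equiv.sum_comp ((Equiv.mulRight₀ z hz).trans (Equiv.addLeft y)) (quadraticChar K ·)

theorem sum_hybridChar_add_C_mul (hK : ringChar K ≠ 2) {b : K} (hb : b ∈ A) {g h : K[X]}
    (hdeg : h.natDegree + 1 < g.natDegree) (hhb : h.eval b ≠ 0)
    (hhA : ∀ a ∈ A.erase b, h.eval a = 0) :
    ∑ c : K, hybridChar A ψ (g + C c * h) = 0 := by
  have hval (c : K) : hybridChar A ψ (g + C c * h)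
      = quadraticChar K (g.eval b + c * h.eval b) *
        ((∏ a ∈ A.erase b, quadraticChar K (g.eval a) : ℤ) * ψ g.nextCoeff) := by
    have hlt : (C c * h).natDegree + 1 < g.natDegree := by
      grw [natDegree_C_mul_le]
      exact hdeg
    have hnat : (g + C c * h).natDegree = g.natDegree :=
      natDegree_add_eq_left_of_natDegree_lt (by lia)
    have hnext : (g + C c * h).nextCoeff = g.nextCoeff := by
      rw [nextCoeff_of_natDegree_pos (by lia), nextCoeff_of_natDegree_pos (by lia), hnat,
        coeff_add, coeff_eq_zero_of_natDegree_lt (p := C c * h) (by lia), add_zero]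
    have herase : ∏ a ∈ A.erase b, quadraticChar K ((g + C c * h).eval a)
        = ∏ a ∈ A.erase b, quadraticChar K (g.eval a) :=
      Finset.prod_congr rfl fun a ha => by
        rw [eval_add, eval_mul, hhA a ha, mul_zero, add_zero]
    rw [hybridChar, hnext, ← Finset.mul_prod_erase _ _ hb, herase, Int.cast_mul, mul_assoc,
      eval_add, eval_mul, eval_C]
  simp only [hval, ← Finset.sum_mul, ← Int.cast_sum, sum_quadraticChar_add_mul hK _ hhb,
    Int.cast_zero, zero_mul]

theorem coeff_lSeries_hybridChar_eq_zero (hK : ringChar K ≠ 2) (hA : A.Nonempty) {n : ℕ}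
    (hn : #A < n) : PowerSeries.coeff n (lSeries (hybridChar A ψ)) = 0 := by
  obtain ⟨b, hb⟩ := hA
  set h : K[X] := ∏ a ∈ A.erase b, (X - C a) with hh
  have hdeg : h.natDegree + 1 = #A := by
    rw [hh, natDegree_prod_of_monic _ _ fun a _ => monic_X_sub_C a]
    simp only [natDegree_X_sub_C, Finset.sum_const, smul_eq_mul, mul_one,
      Finset.card_erase_add_one hb]
  have hhb : h.eval b ≠ 0 := by
    rw [hh, eval_prod, Finset.prod_ne_zero_iff]
    intro a ha
    simpa [sub_eq_zero] using (Finset.ne_of_mem_erase ha).symm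
  have hhA : ∀ a ∈ A.erase b, h.eval a = 0 := fun a ha => by
    rw [hh, eval_prod]
    exact Finset.prod_eq_zero ha (by simp)
  have hshift (c : K) : ∑ g ∈ monicFinset K n, hybridChar A ψ (g + C c * h)
      = ∑ g ∈ monicFinset K n, hybridChar A ψ g :=
    sum_monicFinset_add ((natDegree_C_mul_le c h).trans_lt (by lia)) _
  have havg : ∑ c : K, ∑ g ∈ monicFinset K n, hybridChar A ψ (g + C c * h) = 0 := by
    rw [Finset.sum_comm]
    refine Finset.sum_eq_zero fun g hg => ?_
    obtain ⟨-, rfl⟩ := mem_monicFinset.1 hg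
    exact sum_hybridChar_add_C_mul A ψ hK hb (by lia) hhb hhA
  rw [lSeries, PowerSeries.coeff_mk]
  simpa [hshift] using havg

section Extension

variable {L : Type*} [Field L] [Fintype L] [Algebra K L]

theorem sum_sum_hybridChar_fieldPoly [DecidableEq L] (hK : ringChar K ≠ 2) :
    ∑ ψ : AddChar K ℂ, ∑ x : L, hybridChar A ψ (fieldPoly K x)
      = (∑ z : L, quadraticChar L ((∏ b ∈ A.map ⟨algebraMap K L, (algebraMap K L).injective⟩,
          (C b - (X ^ Fintype.card K - X))).eval z) : ℤ) := by
  have hsum := sum_sum_mul_addChar_trace (K := K) fun x : L =>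
    ((∏ a ∈ A, quadraticChar L (algebraMap K L a - x) : ℤ) : ℂ)
  simpa only [hybridChar, eval_fieldPoly, nextCoeff_fieldPoly, quadraticChar_norm hK,
    eval_prod, eval_sub, eval_C, eval_pow, eval_X, map_prod, Finset.prod_map, Int.cast_sum,
    Function.Embedding.coeFn_mk] using hsum

theorem norm_sum_sum_hybridChar_fieldPoly_le (hK : ringChar K ≠ 2) (hA : A.Nonempty) {n : ℕ}
    (hL : finrank K L = n + n) :
    ‖∑ ψ : AddChar K ℂ, ∑ x : L, hybridChar A ψ (fieldPoly K x)‖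
      ≤ (8 * (#A * Fintype.card K) + 6 : ℝ) * (Fintype.card K : ℝ) ^ n := by
  classical
  obtain ⟨p, hp⟩ := CharP.exists K
  have : Fact p.Prime := ⟨CharP.char_is_prime K p⟩
  have := charP_of_injective_algebraMap (algebraMap K L).injective p
  obtain ⟨f, -, hf⟩ := FiniteField.card K p
  have hcard : Fintype.card L = p ^ (f * n) * p ^ (f * n) := by
    rw [Module.card_eq_pow_finrank (K := K), hL, hf, ← pow_mul, ← pow_add, mul_add]
  have hdeg := natDegree_prod_C_sub_X_pow_sub_X
    (A.map ⟨algebraMap K L, (algebraMap K L).injective⟩) (Fintype.one_lt_card (α := K))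
  have hq : ((Fintype.card K : ℕ) : L) = 0 := by
    rw [← map_natCast (algebraMap K L), FiniteField.cast_card_eq_zero, map_zero]
  have hweil := Stepanov.abs_sum_quadraticChar_eval_le (by rwa [← ringChar.eq K p])
    (squarefree_prod_C_sub_X_pow_sub_X
      (A.map ⟨algebraMap K L, (algebraMap K L).injective⟩) hq)
    (by rw [hdeg, Finset.card_map]; exact mul_ne_zero hA.card_ne_zero Fintype.card_ne_zero) hcard
  rw [hdeg, Finset.card_map, pow_mul, ← Nat.cast_pow, ← hf] at hweil
  rw [sum_sum_hybridChar_fieldPoly A hK, Complex.norm_intCast]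
  exact_mod_cast hweil

end Extension

theorem exists_coeff_extensionSeries_eq {L : ℕ → Type*} [∀ r, Field (L r)] [∀ r, Fintype (L r)]
    [∀ r, Algebra K (L r)] (hL : ∀ r, finrank K (L r) = r + 1) (hK : ringChar K ≠ 2)
    (hA : A.Nonempty) :
    ∃ t : Multiset ℂ, t.card ≤ #A ∧
      ∀ r, PowerSeries.coeff r (extensionSeries L (hybridChar A ψ)) =
        -(t.map (· ^ (r + 1))).sum := by
  have htrunc : ((lSeries (hybridChar A ψ)).trunc (#A + 1) : PowerSeries ℂ)
      = lSeries (hybridChar A ψ) := by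
    ext n
    rw [coeff_coe, PowerSeries.coeff_trunc]
    split_ifs with hn
    · rfl
    · exact (coeff_lSeries_hybridChar_eq_zero A ψ hK hA (by lia)).symm
  have hzero : ((lSeries (hybridChar A ψ)).trunc (#A + 1)).coeff 0 = 1 := by
    rw [← coeff_coe, htrunc, coeff_zero_lSeries_hybridChar]
  obtain ⟨t, ht, hcoeff⟩ := exists_coeff_eq_neg_sum_pow hzero
    (S := extensionSeries L (hybridChar A ψ)) (by
      rw [htrunc, derivative_lSeries (fun _ _ hf hg => hybridChar_mul A ψ hf hg) hL])
  exact ⟨t, ht.trans (Nat.lt_succ_iff.1 (PowerSeries.natDegree_trunc_lt _ _)), hcoeff⟩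

theorem norm_le_sqrt_card_of_mem {L : ℕ → Type*} [∀ r, Field (L r)] [∀ r, Fintype (L r)]
    [∀ r, Algebra K (L r)] (hL : ∀ r, finrank K (L r) = r + 1) (hK : ringChar K ≠ 2)
    (hA : A.Nonempty) {t : AddChar K ℂ → Multiset ℂ}
    (ht : ∀ ψ r, PowerSeries.coeff r (extensionSeries L (hybridChar A ψ)) =
      -((t ψ).map (· ^ (r + 1))).sum) {w : ℂ} (hw : w ∈ t ψ) :
    ‖w‖ ≤ √(Fintype.card K) := by
  have hsum (n : ℕ) : ((((Finset.univ.val.bind t).map (· ^ 2)).map (· ^ (n + 1))).sum : ℂ)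
      = -∑ ψ, ∑ x : L (2 * n + 1), hybridChar A ψ (fieldPoly K x) := by
    rw [Multiset.map_map, Multiset.map_bind, Multiset.sum_bind, ← Finset.sum_neg_distrib]
    refine Finset.sum_congr rfl fun ψ _ => ?_
    have h := ht ψ (2 * n + 1)
    rw [extensionSeries, PowerSeries.coeff_mk] at h
    rw [h, neg_neg]
    simp only [Function.comp_def, ← pow_mul]
    rfl
  have hbound (n : ℕ) : ‖(((Finset.univ.val.bind t).map (· ^ 2)).map (· ^ (n + 1))).sum‖
      ≤ (8 * (#A * Fintype.card K) + 6 : ℝ) * (Fintype.card K : ℝ) ^ (n + 1) := by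
    rw [hsum, norm_neg]
    exact norm_sum_sum_hybridChar_fieldPoly_le A hK hA (by rw [hL]; lia)
  refine Real.le_sqrt_of_sq_le ?_
  rw [← norm_pow]
  exact norm_le_of_norm_sum_pow_le (Nat.cast_pos.2 Fintype.card_pos) hbound
    (Multiset.mem_map_of_mem _ (Multiset.mem_bind.2 ⟨ψ, Finset.mem_univ_val ψ, hw⟩))

theorem norm_sum_prod_quadraticChar_mul_le_of_extensions {L : ℕ → Type*} [∀ r, Field (L r)]
    [∀ r, Finite (L r)] [∀ r, Algebra K (L r)] (hL : ∀ r, finrank K (L r) = r + 1)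
    (hK : ringChar K ≠ 2) (hA : A.Nonempty) :
    ‖∑ x : K, (∏ a ∈ A, quadraticChar K (a - x) : ℤ) * ψ (-x)‖ ≤ #A * √(Fintype.card K) := by
  have (r : ℕ) := Fintype.ofFinite (L r)
  choose t hcard ht using fun ψ => exists_coeff_extensionSeries_eq A ψ hL hK hA
  have hcoeff := congrArg (PowerSeries.coeff 0)
    (derivative_lSeries (fun _ _ hf hg => hybridChar_mul A ψ hf hg) hL)
  rw [PowerSeries.coeff_derivative, PowerSeries.coeff_mul, Finset.Nat.antidiagonal_zero,
    Finset.sum_singleton, ht, coeff_zero_lSeries_hybridChar, zero_add,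
    coeff_one_lSeries_hybridChar, Nat.cast_zero, zero_add, mul_one, mul_one] at hcoeff
  simp only [pow_one, Multiset.map_id'] at hcoeff
  rw [hcoeff, norm_neg]
  calc ‖(t ψ).sum‖ ≤ ((t ψ).map (‖·‖)).sum := norm_multiset_sum_le _
    _ ≤ (t ψ).card • √(Fintype.card K) := by
      rw [← Multiset.card_map (‖·‖)]
      refine Multiset.sum_le_card_nsmul _ _ ?_
      simp only [Multiset.mem_map, forall_exists_index, and_imp, forall_apply_eq_imp_iff₂]
      exact fun w hw => norm_le_sqrt_card_of_mem A ψ hL hK hA ht hw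
    _ ≤ #A * √(Fintype.card K) := by
      rw [nsmul_eq_mul]
      gcongr
      exact hcard ψ

theorem norm_sum_prod_quadraticChar_mul_le (hK : ringChar K ≠ 2) (hA : A.Nonempty) :
    ‖∑ x : K, (∏ a ∈ A, quadraticChar K (a - x) : ℤ) * ψ x‖ ≤ #A * √(Fintype.card K) := by
  obtain ⟨p, hp⟩ := CharP.exists K
  have : Fact p.Prime := ⟨CharP.char_is_prime K p⟩
  simpa using norm_sum_prod_quadraticChar_mul_le_of_extensions A ψ⁻¹
    (fun r => FiniteField.finrank_extension K p (r + 1)) hK hA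

end HybridSums

end WeilBound

namespace FacetForm

open scoped Finset Pointwise

section Fourier

variable {G : Type*} [AddCommGroup G] [Fintype G]

theorem sum_addChar_norm_sum_sq (c : G → ℂ) :
    ∑ ψ : AddChar G ℂ, ‖∑ x, c x * ψ x‖ ^ 2 = Fintype.card G * ∑ x, ‖c x‖ ^ 2 := by
  classical
  have expand (ψ : AddChar G ℂ) :
      ((‖∑ x, c x * ψ x‖ ^ 2 : ℝ) : ℂ) = ∑ x, ∑ y, c x * starRingEnd ℂ (c y) * ψ (x - y) := by
    rw [Complex.ofReal_pow, ← Complex.mul_conj', map_sum, Finset.sum_mul_sum]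
    refine Finset.sum_congr rfl fun x _ => Finset.sum_congr rfl fun y _ => ?_
    rw [map_mul, ← AddChar.map_neg_eq_conj, sub_eq_add_neg, AddChar.map_add_eq_mul]
    ring
  have orthogonality (x : G) : ∑ ψ : AddChar G ℂ, ∑ y, c x * starRingEnd ℂ (c y) * ψ (x - y) =
      Fintype.card G * (c x * starRingEnd ℂ (c x)) := by
    rw [Finset.sum_comm]
    simp only [← Finset.mul_sum, AddChar.sum_apply_eq_ite, sub_eq_zero, mul_ite, mul_zero,
      Finset.sum_ite_eq, Finset.mem_univ, if_true]
    ring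
  apply Complex.ofReal_injective
  rw [Complex.ofReal_sum, Finset.sum_congr rfl fun ψ _ => expand ψ, Finset.sum_comm,
    Finset.sum_congr rfl fun x _ => orthogonality x, ← Finset.mul_sum]
  simp only [Complex.mul_conj']
  push_cast
  rfl

variable {g a b : G → ℝ} {M : ℝ}

theorem sum_correlation_mul_addChar (g b : G → ℝ) (ψ : AddChar G ℂ) :
    ∑ x, ((∑ y, g (x + y) * b y : ℝ) : ℂ) * ψ x =
      (∑ x, g x * ψ x) * ∑ y, b y * (-ψ) y := by
  rw [mul_comm, Finset.sum_mul_sum]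
  push_cast
  simp only [Finset.sum_mul]
  rw [Finset.sum_comm]
  refine Finset.sum_congr rfl fun y _ => ?_
  have hψ : ψ y * (-ψ) y = 1 := by rw [← AddChar.add_apply, add_neg_cancel, AddChar.zero_apply]
  rw [← Equiv.sum_comp (Equiv.addRight y) fun t => (b y : ℂ) * (-ψ) y * (g t * ψ t)]
  refine Finset.sum_congr rfl fun x _ => ?_
  rw [Equiv.coe_addRight, AddChar.map_add_eq_mul]
  linear_combination (-(g (x + y) : ℂ) * b y * ψ x) * hψ

theorem sum_correlation_sq_le
    (hg : ∀ ψ : AddChar G ℂ, ‖∑ x, (g x : ℂ) * ψ x‖ ≤ M) :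
    ∑ x, (∑ y, g (x + y) * b y) ^ 2 ≤ M ^ 2 * ∑ y, b y ^ 2 := by
  have parseval (c : G → ℝ) :
      ∑ ψ : AddChar G ℂ, ‖∑ x, (c x : ℂ) * ψ x‖ ^ 2 = Fintype.card G * ∑ x, c x ^ 2 := by
    simpa only [Complex.norm_real, Real.norm_eq_abs, sq_abs] using
      sum_addChar_norm_sum_sq fun x => (c x : ℂ)
  refine le_of_mul_le_mul_left ?_ (Nat.cast_pos.2 (Fintype.card_pos (α := G)) : (0 : ℝ) < _)
  calc Fintype.card G * ∑ x, (∑ y, g (x + y) * b y) ^ 2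
      = ∑ ψ : AddChar G ℂ, ‖∑ x, g x * ψ x‖ ^ 2 * ‖∑ y, b y * (-ψ) y‖ ^ 2 := by
        simp only [← parseval, sum_correlation_mul_addChar, norm_mul, mul_pow]
    _ ≤ ∑ ψ : AddChar G ℂ, M ^ 2 * ‖∑ y, b y * (-ψ) y‖ ^ 2 := by
        gcongr with ψ
        exact hg ψ
    _ = M ^ 2 * ∑ ψ : AddChar G ℂ, ‖∑ y, b y * ψ y‖ ^ 2 := by
        rw [← Finset.mul_sum]
        exact congrArg _ <| Equiv.sum_comp (Equiv.neg (AddChar G ℂ)) fun ψ =>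
          ‖∑ y, (b y : ℂ) * ψ y‖ ^ 2
    _ = Fintype.card G * (M ^ 2 * ∑ y, b y ^ 2) := by
        rw [parseval]
        ring

theorem sum_sq_le_card {ι : Type*} [Fintype ι] {f : ι → ℝ} (hf : ∀ i, |f i| ≤ 1) :
    ∑ i, f i ^ 2 ≤ Fintype.card ι := by
  simpa using Finset.sum_le_card_nsmul Finset.univ _ 1 fun i _ =>
    (sq_le_one_iff_abs_le_one _).2 (hf i)

theorem abs_sum_sum_add_mul_le (hg : ∀ ψ : AddChar G ℂ, ‖∑ x, (g x : ℂ) * ψ x‖ ≤ M)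
    (ha : ∀ x, |a x| ≤ 1) (hb : ∀ y, |b y| ≤ 1) :
    |∑ x, a x * ∑ y, g (x + y) * b y| ≤ Fintype.card G * M := by
  have hM : 0 ≤ M := (norm_nonneg _).trans (hg 0)
  refine abs_le_of_sq_le_sq ?_ (by positivity)
  calc (∑ x, a x * ∑ y, g (x + y) * b y) ^ 2
      ≤ (∑ x, a x ^ 2) * ∑ x, (∑ y, g (x + y) * b y) ^ 2 := Finset.sum_mul_sq_le_sq_mul_sq _ _ _
    _ ≤ Fintype.card G * (M ^ 2 * Fintype.card G) := by
        gcongr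
        · exact sum_sq_le_card ha
        · exact (sum_correlation_sq_le hg).trans (by gcongr; exact sum_sq_le_card hb)
    _ = (Fintype.card G * M) ^ 2 := by ring

end Fourier

section Form

variable {G : Type*} [AddCommGroup G] [Fintype G] {n : ℕ}

/-- The multilinear form with kernel `g (x₀ + ⋯ + x_n)` in functions `f₀, …, f_n` of `n` variables,
where `f_i` is evaluated at the tuple `x` with the coordinate `x_i` left out. -/
def facetForm (g : G → ℝ) (f : Fin (n + 1) → (Fin n → G) → ℝ) : ℝ :=
  ∑ x : Fin (n + 1) → G, g (∑ i, x i) * ∏ i, f i (i.removeNth x)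

theorem sum_fin_cons {α M : Type*} [Fintype α] [AddCommMonoid M] (F : (Fin (n + 1) → α) → M) :
    ∑ x, F x = ∑ y : Fin n → α, ∑ x₀ : α, F (Fin.cons x₀ y) := by
  rw [Finset.sum_comm, ← Fintype.sum_prod_type']
  exact (Equiv.sum_comp (Fin.consEquiv fun _ => α) F).symm

theorem removeNth_succ_cons {α : Type*} (i : Fin (n + 1)) (x₀ : α) (y : Fin (n + 1) → α) :
    i.succ.removeNth (Fin.cons x₀ y : Fin (n + 2) → α) = Fin.cons x₀ (i.removeNth y) := by
  funext j
  refine Fin.cases ?_ (fun j => ?_) j <;> simp [Fin.removeNth]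

theorem abs_prod_le_one {ι : Type*} (s : Finset ι) {f : ι → ℝ} (hf : ∀ i ∈ s, |f i| ≤ 1) :
    |∏ i ∈ s, f i| ≤ 1 := by
  rw [Finset.abs_prod]
  exact Finset.prod_le_one (fun _ _ => abs_nonneg _) hf

theorem abs_mul_le_one {a b : ℝ} (ha : |a| ≤ 1) (hb : |b| ≤ 1) : |a * b| ≤ 1 :=
  abs_mul a b ▸ mul_le_one₀ ha (abs_nonneg b) hb

theorem abs_facetForm_le_card_pow {g : G → ℝ} (hg : ∀ s, |g s| ≤ 1)
    {f : Fin (n + 1) → (Fin n → G) → ℝ} (hf : ∀ i y, |f i y| ≤ 1) :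
    |facetForm g f| ≤ (Fintype.card G : ℝ) ^ (n + 1) := by
  have hterm (x : Fin (n + 1) → G) : |g (∑ i, x i) * ∏ i, f i (i.removeNth x)| ≤ 1 :=
    abs_mul_le_one (hg _) (abs_prod_le_one _ fun i _ => hf i _)
  refine (Finset.abs_sum_le_sum_abs _ _).trans
    ((Finset.sum_le_card_nsmul _ _ 1 fun x _ => hterm x).trans_eq ?_)
  simp

theorem facetForm_two_variables (g : G → ℝ) (f : Fin 2 → (Fin 1 → G) → ℝ) :
    facetForm g f = ∑ x, f 1 (fun _ => x) * ∑ y, g (x + y) * f 0 fun _ => y := by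
  simp only [facetForm, Finset.mul_sum]
  rw [← (finTwoArrowEquiv G).symm.sum_comp, Fintype.sum_prod_type]
  refine Finset.sum_congr rfl fun x _ => Finset.sum_congr rfl fun y _ => ?_
  have h₀ : (0 : Fin 2).removeNth ![x, y] = fun _ => y := by
    funext j
    fin_cases j
    rfl
  have h₁ : (1 : Fin 2).removeNth ![x, y] = fun _ => x := by
    funext j
    fin_cases j
    rfl
  rw [finTwoArrowEquiv_symm_apply, Fin.sum_univ_two, Fin.prod_univ_two, h₀, h₁]
  simp only [Matrix.cons_val_zero, Matrix.cons_val_one]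
  ring

theorem facetForm_eq_sum_mul_sum (g : G → ℝ) (f : Fin (n + 2) → (Fin (n + 1) → G) → ℝ) :
    facetForm g f = ∑ y, f 0 y * ∑ x₀, g (x₀ + ∑ i, y i) *
      ∏ i : Fin (n + 1), f i.succ (Fin.cons x₀ (i.removeNth y)) := by
  simp only [facetForm, sum_fin_cons (n := n + 1), Finset.mul_sum]
  refine Finset.sum_congr rfl fun y _ => Finset.sum_congr rfl fun x₀ _ => ?_
  rw [Fin.sum_univ_succ, Fin.prod_univ_succ]
  simp only [removeNth_succ_cons, Fin.cons_zero, Fin.cons_succ, Fin.removeNth_zero, Fin.tail_cons]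
  ring

theorem sq_sum_eq_sum_sum_mul_shift (F : G → ℝ) :
    (∑ x, F x) ^ 2 = ∑ h, ∑ x, F x * F (x + h) := by
  rw [sq, Finset.sum_mul_sum, Finset.sum_comm (f := fun h x => F x * F (x + h))]
  exact Finset.sum_congr rfl fun x _ =>
    (Equiv.sum_comp (Equiv.addLeft x) fun z => F x * F z).symm

/-- One step of the Cauchy–Schwarz argument: the function that does not depend on the first
variable disappears, at the price of replacing everything else by its product with a shift. -/
theorem sq_facetForm_le (g : G → ℝ) {f : Fin (n + 2) → (Fin (n + 1) → G) → ℝ}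
    (hf : ∀ y, |f 0 y| ≤ 1) :
    facetForm g f ^ 2 ≤ (Fintype.card G : ℝ) ^ (n + 1) * ∑ h : G, ∑ x₀ : G,
      facetForm (fun s => g (x₀ + s) * g (x₀ + h + s)) fun i w =>
        f i.succ (Fin.cons x₀ w) * f i.succ (Fin.cons (x₀ + h) w) := by
  set F : (Fin (n + 1) → G) → G → ℝ := fun y x₀ =>
    g (x₀ + ∑ i, y i) * ∏ i : Fin (n + 1), f i.succ (Fin.cons x₀ (i.removeNth y))
  have hcard : ∑ y, f 0 y ^ 2 ≤ (Fintype.card G : ℝ) ^ (n + 1) := by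
    simpa using sum_sq_le_card hf
  have hsq : ∑ y, (∑ x₀, F y x₀) ^ 2 = ∑ h : G, ∑ x₀ : G,
      facetForm (fun s => g (x₀ + s) * g (x₀ + h + s)) fun i w =>
        f i.succ (Fin.cons x₀ w) * f i.succ (Fin.cons (x₀ + h) w) := by
    simp only [sq_sum_eq_sum_sum_mul_shift]
    rw [Finset.sum_comm]
    refine Finset.sum_congr rfl fun h _ => ?_
    rw [Finset.sum_comm]
    refine Finset.sum_congr rfl fun x₀ _ => Finset.sum_congr rfl fun y _ => ?_
    rw [Finset.prod_mul_distrib]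
    ring
  rw [facetForm_eq_sum_mul_sum, ← hsq]
  refine (Finset.sum_mul_sq_le_sq_mul_sq _ _ _).trans ?_
  exact mul_le_mul_of_nonneg_right hcard (Finset.sum_nonneg fun _ _ => sq_nonneg _)

end Form

section QuadraticChar

theorem card_image_union_image_sub_le {G : Type*} [AddGroup G] [DecidableEq G] (A : Finset G)
    (h x : G) :
    #((A ∪ A.image (· - h)).image (· - x)) ≤ 2 * #A := by
  grw [Finset.card_image_le, Finset.card_union_le, Finset.card_image_le, two_mul]

variable {K : Type*} [Field K] [Fintype K] [DecidableEq K]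

/-- The product of the translates `s ↦ χ (a - s)`, `a ∈ A`, of the quadratic character. -/
def shiftedCharProd (A : Finset K) (s : K) : ℝ :=
  (∏ a ∈ A, quadraticChar K (a - s) : ℤ)

theorem abs_shiftedCharProd_le_one (A : Finset K) (s : K) : |shiftedCharProd A s| ≤ 1 := by
  rw [shiftedCharProd, Int.cast_prod]
  exact abs_prod_le_one _ fun a _ => mod_cast Stepanov.abs_quadraticChar_le_one (a - s)

theorem shiftedCharProd_add (A : Finset K) (x s : K) :
    shiftedCharProd A (x + s) = shiftedCharProd (A.image (· - x)) s := by
  rw [shiftedCharProd, shiftedCharProd, Finset.prod_image (sub_left_injective.injOn)]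
  simp only [sub_sub]

theorem shiftedCharProd_mul_add {A : Finset K} {h : K} (hh : ∀ a ∈ A, ∀ b ∈ A, a - b ≠ h) (s : K) :
    shiftedCharProd A s * shiftedCharProd A (s + h) =
      shiftedCharProd (A ∪ A.image (· - h)) s := by
  have hdisj : Disjoint A (A.image (· - h)) := by
    simp only [Finset.disjoint_left, Finset.mem_image, not_exists, not_and]
    exact fun b hb a ha hab => hh a ha b hb (by linear_combination hab)
  rw [add_comm, shiftedCharProd_add, shiftedCharProd, shiftedCharProd, shiftedCharProd,
    Finset.prod_union hdisj, Int.cast_mul]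

theorem abs_facetForm_shiftedCharProd_two_le (hK : ringChar K ≠ 2) {A : Finset K}
    (hA : A.Nonempty) {f : Fin 2 → (Fin 1 → K) → ℝ} (hf : ∀ i y, |f i y| ≤ 1) :
    |facetForm (shiftedCharProd A) f| ≤ Fintype.card K * (#A * √(Fintype.card K)) := by
  rw [facetForm_two_variables]
  refine abs_sum_sum_add_mul_le (fun ψ => ?_) (fun _ => hf 1 _) fun _ => hf 0 _
  simpa [shiftedCharProd] using WeilBound.norm_sum_prod_quadraticChar_mul_le A ψ hK hA

theorem sum_le_card_mul_add {ι : Type*} [Fintype ι] {t : ι → ℝ} (B : Finset ι) {c d : ℝ}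
    (hd : 0 ≤ d) (hB : ∀ i ∈ B, t i ≤ c) (hBc : ∀ i ∉ B, t i ≤ d) :
    ∑ i, t i ≤ #B * c + Fintype.card ι * d := by
  classical
  rw [← Finset.sum_add_sum_compl B]
  refine add_le_add ((Finset.sum_le_card_nsmul B t c hB).trans_eq (nsmul_eq_mul _ _)) ?_
  refine (Finset.sum_le_card_nsmul Bᶜ t d fun i hi => hBc i (Finset.mem_compl.1 hi)).trans ?_
  rw [nsmul_eq_mul]
  gcongr
  exact Finset.card_le_univ _

theorem shiftedCharProd_mul_shift {A : Finset K} {h : K} (hh : h ∉ A - A) (x s : K) :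
    shiftedCharProd A (x + s) * shiftedCharProd A (x + h + s) =
      shiftedCharProd ((A ∪ A.image (· - h)).image (· - x)) s := by
  rw [← shiftedCharProd_add, ← shiftedCharProd_mul_add, add_right_comm]
  exact fun a ha b hb hab => hh (hab ▸ Finset.sub_mem_sub ha hb)

theorem sq_facetForm_shiftedCharProd_le {n : ℕ} {A : Finset K} (hA : A.Nonempty)
    {f : Fin (n + 2) → (Fin (n + 1) → K) → ℝ} (hf : ∀ i y, |f i y| ≤ 1) {c : ℝ} (hc : 0 ≤ c)
    (hdouble : ∀ B : Finset K, B.Nonempty → #B ≤ 2 * #A →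
      ∀ f' : Fin (n + 1) → (Fin n → K) → ℝ, (∀ i y, |f' i y| ≤ 1) →
        |facetForm (shiftedCharProd B) f'| ≤ c) :
    facetForm (shiftedCharProd A) f ^ 2 ≤ (Fintype.card K : ℝ) ^ (n + 1) *
      (#A ^ 2 * (Fintype.card K * (Fintype.card K : ℝ) ^ (n + 1)) +
        Fintype.card K * (Fintype.card K * c)) := by
  set T : K → K → ℝ := fun h x₀ =>
    facetForm (fun s => shiftedCharProd A (x₀ + s) * shiftedCharProd A (x₀ + h + s)) fun i w =>
      f i.succ (Fin.cons x₀ w) * f i.succ (Fin.cons (x₀ + h) w)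
  have trivial_bound (h x₀) : T h x₀ ≤ (Fintype.card K : ℝ) ^ (n + 1) :=
    (le_abs_self _).trans <| abs_facetForm_le_card_pow
      (fun s => abs_mul_le_one (abs_shiftedCharProd_le_one _ _) (abs_shiftedCharProd_le_one _ _))
      fun i w => abs_mul_le_one (hf _ _) (hf _ _)
  have generic_bound (h) (hh : h ∉ A - A) (x₀) : T h x₀ ≤ c := by
    simp only [T, shiftedCharProd_mul_shift hh]
    exact (le_abs_self _).trans <| hdouble _ (by simpa using hA)
      (card_image_union_image_sub_le A h x₀) _ fun i w => abs_mul_le_one (hf _ _) (hf _ _)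
  have hrow {h : K} {d : ℝ} (hd : ∀ x₀, T h x₀ ≤ d) : ∑ x₀, T h x₀ ≤ Fintype.card K * d := by
    simpa using Finset.sum_le_card_nsmul Finset.univ (T h) d fun x₀ _ => hd x₀
  refine (sq_facetForm_le _ (hf 0)).trans ?_
  gcongr
  refine (sum_le_card_mul_add (A - A) (by positivity) (fun h _ => hrow (trivial_bound h))
    fun h hh => hrow (generic_bound h hh)).trans ?_
  gcongr
  rw [sq]
  exact_mod_cast Finset.card_sub_le

theorem one_le_mul_rpow_neg {q : ℝ} (hq : 1 ≤ q) (n : ℕ) :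
    1 ≤ q * q ^ (-((2 : ℝ) ^ n)⁻¹) := by
  have hexp : 0 ≤ 1 + -((2 : ℝ) ^ n)⁻¹ := by
    linarith [inv_le_one_of_one_le₀ (one_le_pow₀ one_le_two : (1 : ℝ) ≤ 2 ^ n)]
  simpa only [Real.rpow_add (zero_lt_one.trans_le hq), Real.rpow_one] using
    Real.one_le_rpow hq hexp

theorem sq_rpow_neg_inv_two_pow_succ {q : ℝ} (hq : 0 ≤ q) (n : ℕ) :
    (q ^ (-((2 : ℝ) ^ (n + 1))⁻¹)) ^ 2 = q ^ (-((2 : ℝ) ^ n)⁻¹) := by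
  rw [← Real.rpow_mul_natCast hq]
  congr 1
  rw [pow_succ]
  push_cast
  field_simp

theorem abs_facetForm_shiftedCharProd_le (hK : ringChar K ≠ 2) (n : ℕ) {A : Finset K}
    (hA : A.Nonempty) {f : Fin (n + 2) → (Fin (n + 1) → K) → ℝ} (hf : ∀ i y, |f i y| ≤ 1) :
    |facetForm (shiftedCharProd A) f| ≤ 3 * #A *
      ((Fintype.card K : ℝ) ^ (n + 2) * (Fintype.card K : ℝ) ^ (-((2 : ℝ) ^ (n + 1))⁻¹)) := by
  set q : ℝ := (Fintype.card K : ℝ) with hq_def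
  have hq : 1 ≤ q := Nat.one_le_cast.2 Fintype.card_pos
  induction n generalizing A with
  | zero =>
    have hsqrt : √q = q * q ^ (-((2 : ℝ) ^ (0 + 1))⁻¹) := by
      rw [← Real.rpow_one_add' (by positivity) (by norm_num), Real.sqrt_eq_rpow]
      norm_num
    refine (abs_facetForm_shiftedCharProd_two_le hK hA hf).trans ?_
    rw [← hq_def, hsqrt]
    nlinarith [show 0 ≤ q * (#A * (q * q ^ (-((2 : ℝ) ^ (0 + 1))⁻¹))) by positivity]
  | succ n ih =>
    set ε := q ^ (-((2 : ℝ) ^ (n + 1))⁻¹)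
    have hA1 : (1 : ℝ) ≤ #A := mod_cast hA.card_pos
    have hdouble (B : Finset K) (hB : B.Nonempty) (hcard : #B ≤ 2 * #A)
        (f' : Fin (n + 2) → (Fin (n + 1) → K) → ℝ) (hf' : ∀ i y, |f' i y| ≤ 1) :
        |facetForm (shiftedCharProd B) f'| ≤ 3 * (2 * #A) * (q ^ (n + 2) * ε) :=
      (ih hB hf').trans (by gcongr; exact_mod_cast hcard)
    refine abs_le_of_sq_le_sq ?_ (by positivity)
    calc facetForm (shiftedCharProd A) f ^ 2
        ≤ q ^ (n + 2) * (#A ^ 2 * (q * q ^ (n + 2)) +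
            q * (q * (3 * (2 * #A) * (q ^ (n + 2) * ε)))) :=
          sq_facetForm_shiftedCharProd_le hA hf (by positivity) hdouble
      _ = q * (q ^ (n + 2)) ^ 2 * (#A ^ 2 * 1 + 6 * (1 * #A) * (q * ε)) := by ring
      _ ≤ q * (q ^ (n + 2)) ^ 2 * (#A ^ 2 * (q * ε) + 6 * (#A * #A) * (q * ε)) := by
          gcongr
          exact one_le_mul_rpow_neg hq (n + 1)
      _ ≤ (3 * #A * q ^ (n + 3)) ^ 2 * ε := by
          have : 0 ≤ (#A * q ^ (n + 3)) ^ 2 * ε := by positivity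
          linear_combination 2 * this
      _ = (3 * #A * (q ^ (n + 1 + 2) * q ^ (-((2 : ℝ) ^ (n + 1 + 1))⁻¹))) ^ 2 := by
          rw [← mul_assoc, mul_pow _ (q ^ (-_ : ℝ)), sq_rpow_neg_inv_two_pow_succ (by positivity)]

end QuadraticChar

end FacetForm

namespace SimplexCochain

open scoped Finset

/-- The nontrivial character of `ℤ/2`. -/
noncomputable def sign : AddChar (ZMod 2) ℝ where
  toFun t := if t = 0 then 1 else -1
  map_zero_eq_one' := if_pos rfl
  map_add_eq_mul' := by
    have hcases : ∀ t : ZMod 2, t = 0 ∨ t = 1 := by decide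
    have htwo : (1 : ZMod 2) + 1 = 0 := rfl
    intro s t
    rcases hcases s with rfl | rfl <;> rcases hcases t with rfl | rfl <;> simp [htwo]

theorem sign_apply (t : ZMod 2) : sign t = if t = 0 then 1 else -1 := rfl

theorem sign_sum {ι : Type*} (s : Finset ι) (f : ι → ZMod 2) :
    sign (∑ i ∈ s, f i) = ∏ i ∈ s, sign (f i) :=
  map_prod sign.toMonoidHom (fun i => Multiplicative.ofAdd (f i)) s

theorem abs_sign (t : ZMod 2) : |sign t| = 1 := by
  rw [sign_apply]
  split_ifs <;> simp

section OrderedFaces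

variable {V : Type*} {n : ℕ}

theorem norm_eq_sum_sign [Fintype V] [DecidableEq V] (φ : Cochain V n) :
    (norm φ : ℝ) = (1 / 2) * ((Fintype.card V).choose n : ℝ) - (1 / 2) * ∑ σ, sign (φ σ) := by
  have hcard : ((Fintype.card V).choose n : ℝ) = ∑ _σ : Face V n, (1 : ℝ) := by
    simp [Fintype.card_finset_len]
  rw [hcard, norm, Finset.card_filter, Nat.cast_sum, Finset.mul_sum, Finset.mul_sum,
    ← Finset.sum_sub_distrib]
  refine Finset.sum_congr rfl fun σ _ => ?_
  rw [sign_apply]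
  by_cases h : φ σ = 0 <;> norm_num [h]

/-- The face spanned by a tuple of distinct vertices. -/
def orderedFace (e : Fin n ↪ V) : Face V n :=
  ⟨Finset.univ.map e, by simp⟩

theorem orderedFace_eq_iff {e : Fin n ↪ V} {σ : Face V n} :
    orderedFace e = σ ↔ ∀ i, e i ∈ σ.1 := by
  refine ⟨fun h i => h ▸ Finset.mem_map_of_mem e (Finset.mem_univ i), fun h => Subtype.ext ?_⟩
  refine Finset.eq_of_subset_of_card_le ?_ (σ.2.trans (orderedFace e).2.symm).le
  simpa [orderedFace, Finset.subset_iff] using h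

theorem card_filter_orderedFace_eq [Fintype V] [DecidableEq V] (σ : Face V n) :
    #{e : Fin n ↪ V | orderedFace e = σ} = n.factorial := by
  let restrict : {e : Fin n ↪ V // orderedFace e = σ} ≃ (Fin n ↪ σ.1) :=
    { toFun e := e.1.codRestrict σ.1 (orderedFace_eq_iff.1 e.2)
      invFun e := ⟨e.trans (.subtype _), orderedFace_eq_iff.2 fun i => (e i).2⟩
      left_inv _ := rfl
      right_inv _ := rfl }
  rw [← Fintype.card_subtype, Fintype.card_congr restrict, Fintype.card_embedding_eq,
    Fintype.card_coe, σ.2, Fintype.card_fin, Nat.descFactorial_self]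

theorem sum_orderedFace [Fintype V] (F : Face V n → ℝ) :
    ∑ e : Fin n ↪ V, F (orderedFace e) = n.factorial * ∑ σ, F σ := by
  classical
  rw [← Finset.sum_fiberwise Finset.univ orderedFace, Finset.mul_sum]
  refine Finset.sum_congr rfl fun σ _ => ?_
  rw [Finset.sum_congr rfl fun e he => by rw [(Finset.mem_filter.1 he).2], Finset.sum_const,
    card_filter_orderedFace_eq, nsmul_eq_mul]

/-- The sign of a cochain as a function of tuples of vertices, with the value `1` at tuples with
repeated entries. -/
noncomputable def tupleSign (ψ : Cochain V n) : (Fin n → V) → ℝ :=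
  Function.extend (fun e : Fin n ↪ V => ⇑e) (fun e => sign (ψ (orderedFace e))) 1

theorem tupleSign_embedding (ψ : Cochain V n) (e : Fin n ↪ V) :
    tupleSign ψ e = sign (ψ (orderedFace e)) :=
  DFunLike.coe_injective.extend_apply _ _ e

theorem abs_tupleSign_le_one (ψ : Cochain V n) (y : Fin n → V) : |tupleSign ψ y| ≤ 1 := by
  classical
  rw [tupleSign, Function.extend_def]
  split_ifs
  · exact (abs_sign _).le
  · simp

theorem erase_orderedFace [DecidableEq V] (e : Fin (n + 1) ↪ V) (i : Fin (n + 1))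
    (hi : e i ∈ (orderedFace e).1) :
    (orderedFace e).erase (e i) hi = orderedFace (i.succAboveEmb.trans e) := by
  symm
  rw [orderedFace_eq_iff]
  intro j
  simp [Face.erase, orderedFace, Fin.succAbove_ne]

theorem sign_coboundary_orderedFace [DecidableEq V] (ψ : Cochain V n) (e : Fin (n + 1) ↪ V) :
    sign (coboundary ψ (orderedFace e)) = ∏ i : Fin (n + 1), tupleSign ψ (i.removeNth e) := by
  have hmem (i) : e i ∈ (orderedFace e).1 := Finset.mem_map_of_mem e (Finset.mem_univ i)
  have hbij : Function.Bijective fun i => (⟨e i, hmem i⟩ : (orderedFace e).1) := by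
    refine (Fintype.bijective_iff_injective_and_card _).2
      ⟨fun i j h => e.injective (congrArg Subtype.val h), ?_⟩
    rw [Fintype.card_coe, (orderedFace e).2, Fintype.card_fin]
  rw [coboundary, sign_sum, ← Finset.univ_eq_attach, ← hbij.prod_comp]
  refine Finset.prod_congr rfl fun i _ => ?_
  rw [erase_orderedFace, ← tupleSign_embedding]
  rfl

end OrderedFaces

section Counting

theorem abs_sum_sub_sum_embedding_le {ι α : Type*} [Fintype ι] [DecidableEq ι] [Fintype α]
    {F : (ι → α) → ℝ} (hF : ∀ x, |F x| ≤ 1) :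
    |∑ x, F x - ∑ e : ι ↪ α, F e| ≤
      (Fintype.card α : ℝ) ^ Fintype.card ι -
        ((Fintype.card α).descFactorial (Fintype.card ι) : ℝ) := by
  classical
  set S : Finset (ι → α) := Finset.univ.map ⟨fun e : ι ↪ α => ⇑e, DFunLike.coe_injective⟩
  have hS : ∑ e : ι ↪ α, F e = ∑ x ∈ S, F x := by simp [S]
  have hcard : (#Sᶜ : ℝ) = (Fintype.card α : ℝ) ^ Fintype.card ι -
      ((Fintype.card α).descFactorial (Fintype.card ι) : ℝ) := by
    rw [Finset.card_compl, Nat.cast_sub (Finset.card_le_univ _), Finset.card_map, Finset.card_univ,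
      Fintype.card_embedding_eq, Fintype.card_fun, Nat.cast_pow]
  rw [hS, ← Finset.sum_add_sum_compl S, add_sub_cancel_left, ← hcard]
  refine (Finset.abs_sum_le_sum_abs _ _).trans ?_
  simpa using Finset.sum_le_card_nsmul Sᶜ _ 1 fun x _ => hF x

theorem pow_succ_le_descFactorial_add (N n : ℕ) :
    N ^ (n + 1) ≤ N.descFactorial (n + 1) + (n + 1) ^ 2 * N ^ n := by
  induction n with
  | zero => simp
  | succ n ih =>
    have hstep : N * N.descFactorial (n + 1) ≤
        N.descFactorial (n + 2) + (n + 1) * N.descFactorial (n + 1) := by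
      rw [Nat.descFactorial_succ N (n + 1), ← add_mul]
      gcongr
      omega
    calc N ^ (n + 2) = N * N ^ (n + 1) := pow_succ' N (n + 1)
      _ ≤ N * (N.descFactorial (n + 1) + (n + 1) ^ 2 * N ^ n) := by gcongr
      _ = N * N.descFactorial (n + 1) + (n + 1) ^ 2 * N ^ (n + 1) := by ring
      _ ≤ N.descFactorial (n + 2) + (n + 1) * N ^ (n + 1) + (n + 1) ^ 2 * N ^ (n + 1) := by
        gcongr ?_ + _
        exact hstep.trans (by gcongr; exact Nat.descFactorial_le_pow ..)
      _ ≤ N.descFactorial (n + 2) + (n + 1 + 1) ^ 2 * N ^ (n + 1) := by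
        rw [add_assoc, ← add_mul]
        gcongr
        nlinarith

theorem pow_succ_le_mul_descFactorial {N n : ℕ} (h : n < N) :
    N ^ (n + 1) ≤ (n + 1) ^ (n + 1) * N.descFactorial (n + 1) := by
  have hbase : N ≤ (n + 1) * (N + 1 - (n + 1)) := by
    obtain ⟨m, rfl⟩ := Nat.exists_eq_add_of_lt h
    rw [show n + m + 1 + 1 - (n + 1) = m + 1 by omega]
    nlinarith
  calc N ^ (n + 1) ≤ ((n + 1) * (N + 1 - (n + 1))) ^ (n + 1) := by gcongr
    _ = (n + 1) ^ (n + 1) * (N + 1 - (n + 1)) ^ (n + 1) := mul_pow _ _ _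
    _ ≤ (n + 1) ^ (n + 1) * N.descFactorial (n + 1) := by
      gcongr
      exact Nat.pow_sub_le_descFactorial N (n + 1)

theorem card_filter_sum_eq_zero (G : Type*) [AddCommGroup G] [Fintype G] [DecidableEq G] (n : ℕ) :
    #{x : Fin (n + 1) → G | ∑ i, x i = 0} = Fintype.card G ^ n := by
  rw [Finset.card_filter, FacetForm.sum_fin_cons]
  simp [Fin.sum_univ_succ, add_eq_zero_iff_eq_neg]

end Counting

section Paley

open FacetForm

variable {p : ℕ} [Fact p.Prime] {k : ℕ}

theorem sign_paley_orderedFace (e : Fin (k + 1) ↪ ZMod p) :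
    sign (paley p k (orderedFace e)) =
      -(quadraticChar (ZMod p) (∑ i, e i) : ℝ) + if ∑ i, e i = 0 then 1 else 0 := by
  rw [paley, orderedFace, Finset.sum_map, sign_apply]
  by_cases h : ∑ i, e i = 0
  · simp [h]
  · have hne : (-1 : ℤ) ≠ 1 := by norm_num
    rcases quadraticChar_dichotomy h with h' | h' <;> simp [h, h', hne]

theorem abs_facetForm_quadraticChar_le (hp : p ≠ 2) {f : Fin (k + 2) → (Fin (k + 1) → ZMod p) → ℝ}
    (hf : ∀ i y, |f i y| ≤ 1) :
    |facetForm (fun s => (quadraticChar (ZMod p) s : ℝ)) f| ≤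
      3 * ((p : ℝ) ^ (k + 2) * (p : ℝ) ^ (-((2 : ℝ) ^ (k + 1))⁻¹)) := by
  have hsign : |(quadraticChar (ZMod p) (-1) : ℝ)| = 1 := by
    rcases quadraticChar_dichotomy (neg_ne_zero.2 (one_ne_zero (α := ZMod p))) with h | h <;>
      simp [h]
  have hform : facetForm (shiftedCharProd {0}) f =
      quadraticChar (ZMod p) (-1) * facetForm (fun s => (quadraticChar (ZMod p) s : ℝ)) f := by
    simp only [facetForm, shiftedCharProd, Finset.prod_singleton, zero_sub, Finset.mul_sum]
    refine Finset.sum_congr rfl fun x _ => ?_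
    rw [neg_eq_neg_one_mul, map_mul, Int.cast_mul, mul_assoc]
  have h := abs_facetForm_shiftedCharProd_le (by rwa [ZMod.ringChar_zmod_n]) k
    (Finset.singleton_nonempty (0 : ZMod p)) hf
  rwa [hform, abs_mul, hsign, one_mul, Finset.card_singleton, Nat.cast_one, mul_one,
    ZMod.card] at h

theorem sign_paley_add_coboundary_le (ψ : Cochain (ZMod p) k) (e : Fin (k + 1) ↪ ZMod p) :
    sign ((paley p k + coboundary ψ) (orderedFace e)) ≤
      -(quadraticChar (ZMod p) (∑ i, e i) * ∏ i : Fin (k + 1), tupleSign ψ (i.removeNth e)) +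
        if ∑ i, e i = 0 then 1 else 0 := by
  rw [Pi.add_apply, AddChar.map_add_eq_mul, sign_coboundary_orderedFace, sign_paley_orderedFace,
    add_mul, neg_mul]
  gcongr
  split_ifs
  · rw [one_mul]
    exact (abs_le.1 (abs_prod_le_one _ fun i _ => abs_tupleSign_le_one ψ _)).2
  · rw [zero_mul]

theorem factorial_mul_sum_sign_le (hp : p ≠ 2) (ψ : Cochain (ZMod p) (k + 1)) :
    (k + 2).factorial * ∑ σ, sign ((paley p (k + 1) + coboundary ψ) σ) ≤
      3 * ((p : ℝ) ^ (k + 2) * (p : ℝ) ^ (-((2 : ℝ) ^ (k + 1))⁻¹)) +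
        ((k + 2) ^ 2 + 1) * (p : ℝ) ^ (k + 1) := by
  set F : (Fin (k + 2) → ZMod p) → ℝ := fun x =>
    quadraticChar (ZMod p) (∑ i, x i) * ∏ i : Fin (k + 2), tupleSign ψ (i.removeNth x)
  have all_tuples : |∑ x, F x| ≤ 3 * ((p : ℝ) ^ (k + 2) * (p : ℝ) ^ (-((2 : ℝ) ^ (k + 1))⁻¹)) :=
    abs_facetForm_quadraticChar_le hp fun _ => abs_tupleSign_le_one ψ
  have repeated_entries : |∑ x, F x - ∑ e : Fin (k + 2) ↪ ZMod p, F e| ≤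
      (k + 2) ^ 2 * (p : ℝ) ^ (k + 1) := by
    have hF (x) : |F x| ≤ 1 := abs_mul_le_one
      (mod_cast Stepanov.abs_quadraticChar_le_one (∑ i, x i))
      (abs_prod_le_one _ fun _ _ => abs_tupleSign_le_one ψ _)
    refine (abs_sum_sub_sum_embedding_le hF).trans ?_
    rw [ZMod.card, Fintype.card_fin, sub_le_iff_le_add']
    exact_mod_cast pow_succ_le_descFactorial_add p (k + 1)
  have zero_sums : ∑ e : Fin (k + 2) ↪ ZMod p, (if ∑ i, e i = 0 then (1 : ℝ) else 0) ≤
      (p : ℝ) ^ (k + 1) := by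
    have hcard := card_filter_sum_eq_zero (ZMod p) (k + 1)
    rw [ZMod.card] at hcard
    rw [Finset.sum_boole, ← Nat.cast_pow, Nat.cast_le, ← hcard]
    exact Finset.card_le_card_of_injOn (fun e => ⇑e) (by simp [Set.MapsTo])
      DFunLike.coe_injective.injOn
  have pointwise := Finset.sum_le_sum fun e (_ : e ∈ Finset.univ) =>
    sign_paley_add_coboundary_le ψ e
  rw [Finset.sum_add_distrib, Finset.sum_neg_distrib,
    sum_orderedFace fun σ => sign ((paley p (k + 1) + coboundary ψ) σ)] at pointwise
  linarith [(abs_le.1 all_tuples).1, (abs_le.1 repeated_entries).2]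

theorem sum_sign_le (hp : p ≠ 2) (hk : k + 1 < p) (ψ : Cochain (ZMod p) (k + 1)) :
    ∑ σ, sign ((paley p (k + 1) + coboundary ψ) σ) ≤ (p.choose (k + 2) : ℝ) *
      (((k + 2) ^ 2 + 4) * (k + 2) ^ (k + 2) * (p : ℝ) ^ (-((2 : ℝ) ^ (k + 1))⁻¹)) := by
  set ε : ℝ := (p : ℝ) ^ (-((2 : ℝ) ^ (k + 1))⁻¹)
  have hp1 : (1 : ℝ) ≤ p := Nat.one_le_cast.2 (Fact.out : p.Prime).one_le
  have hpow : (p : ℝ) ^ (k + 1) ≤ (p : ℝ) ^ (k + 2) * ε := by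
    rw [pow_succ _ (k + 1), mul_assoc]
    exact le_mul_of_one_le_right (by positivity) (one_le_mul_rpow_neg hp1 (k + 1))
  have hchoose : (p : ℝ) ^ (k + 2) ≤
      (k + 2) ^ (k + 2) * ((k + 2).factorial * p.choose (k + 2)) := by
    rw [← Nat.cast_mul, ← Nat.descFactorial_eq_factorial_mul_choose]
    exact_mod_cast pow_succ_le_mul_descFactorial hk
  refine le_of_mul_le_mul_left ?_ (mod_cast (k + 2).factorial_pos : (0 : ℝ) < (k + 2).factorial)
  calc (k + 2).factorial * ∑ σ, sign ((paley p (k + 1) + coboundary ψ) σ)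
      ≤ 3 * ((p : ℝ) ^ (k + 2) * ε) + ((k + 2) ^ 2 + 1) * (p : ℝ) ^ (k + 1) :=
        factorial_mul_sum_sign_le hp ψ
    _ ≤ 3 * ((p : ℝ) ^ (k + 2) * ε) + ((k + 2) ^ 2 + 1) * ((p : ℝ) ^ (k + 2) * ε) := by gcongr
    _ = ((k + 2) ^ 2 + 4) * ((p : ℝ) ^ (k + 2) * ε) := by ring
    _ ≤ ((k + 2) ^ 2 + 4) *
          ((k + 2) ^ (k + 2) * ((k + 2).factorial * p.choose (k + 2)) * ε) := by gcongr
    _ = _ := by ring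

theorem exists_cosystolicNorm_eq {V : Type*} [Fintype V] [DecidableEq V] {n : ℕ}
    (φ : Cochain V (n + 1)) : ∃ ψ : Cochain V n, cosystolicNorm φ = norm (φ + coboundary ψ) :=
  (ciInf_mem fun ψ : Cochain V n => norm (φ + coboundary ψ)).imp fun _ => Eq.symm

end Paley

end SimplexCochain

theorem theoremp (k : ℕ) (hk : 1 ≤ k) :
    ∃ C : ℝ, ∀ (p : ℕ) [Fact p.Prime], 2 < p → k < p →
      (1 / 2 : ℝ) * (p.choose (k + 1) : ℝ) * (1 - C * (p : ℝ) ^ (-((2 : ℝ) ^ (-(k : ℝ))))) ≤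
        (SimplexCochain.cosystolicNorm (SimplexCochain.paley p k) : ℝ) := by
  obtain ⟨k, rfl⟩ : ∃ l, k = l + 1 := Nat.exists_eq_add_of_le' hk
  refine ⟨((k + 2) ^ 2 + 4) * (k + 2) ^ (k + 2), fun p _ hp hkp => ?_⟩
  obtain ⟨ψ, hψ⟩ := SimplexCochain.exists_cosystolicNorm_eq (SimplexCochain.paley p (k + 1))
  have hsum := SimplexCochain.sum_sign_le hp.ne' hkp ψ
  rw [hψ, SimplexCochain.norm_eq_sum_sign, ZMod.card, Real.rpow_neg zero_le_two, Real.rpow_natCast]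
  linarith
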